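/- Throughout, a $k$-graph $H=(V(H),E(H))$ is a finite $k$-uniform hypergraph; it is linear if any two distinct edges share at most one vertex. For $A_1,\dots,A_k\subseteq V(H)$ let $e(A_1,\dots,A_k)$ be the number of tuples $(a_1,\dots,a_k)$ with $a_i\in A_i$ that form an edge, and for $v\in V(H)$, $U\subseteq V(H)$ let $\deg_H(v;U)=e(\{v\},U,\dots,U)$. Let $\Delta_2(H)$ be the maximum over pairs $u\ne v$ of the number of edges containing both $u$ and $v$. For $p,\alpha,\varepsilon\in[0,1]$, $H$ is $(p,\alpha,\varepsilon)$-pseudo-random if for all (not necessarily disjoint) $A_1,\dots,A_k\subseteq V(H)$ with $|A_1|\cdots|A_k|\ge\alpha|V(H)|^k$ we have $(1-\varepsilon)p|A_1|\cdots|A_k|\le e(A_1,\dots,A_k)\le(1+\varepsilon)p|A_1|\cdots|A_k|$. A rooted $k$-graph $(A,\mathcal X)$ is a $k$-graph $A$ with a (possibly empty) tuple $\mathcal X=(x_1,\dots,x_r)$ of distinct vertices, the roots, such that for $i\ne j$ every edge containing $x_i$ is disjoint from every edge containing $x_j$. Its edge degeneracy $\mathrm{degen}(A,\mathcal X)$ is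 the least $d$ for which the edges of $A$ can be ordered so that all edges containing a root precede all edges containing no root and every edge intersects at most $d$ of the edges preceding it. A rooted copy of $(A,\mathcal X)$ in $H$ with roots $(y_1,\dots,y_r)$ is an injective map $V(A)\to V(H)$ that maps edges to edges and $x_i$ to $y_i$ for all $i$. An ordered $r$-graph $T$ on a vertex set $V_T$ is a set $E(T)$ of ordered $r$-tuples of distinct vertices of $V_T$ (its edges); $\Delta_1(T)$ is the maximum number of edges containing a given vertex. If $V_T\subseteq V(H)$, a $T$-compatible family of rooted copies of $(A,\mathcal X)$ in $H$ is a family $\{A_e\}_{e\in E(T)}$ such that (1) each $A_e$ is a rooted copy of $(A,\mathcal X)$ in $H$ with roots $e$; (2) the vertex set of each $A_e$ intersects $V_T$ exactly in the vertex set of $e$; (3) for any two distinct edges $e,e'$ the vertex sets of $A_e$ and $A_{e'}$ intersect exactly in $e\cap e'$. **Lemma 2.3.** Given integers $k\ge2$, $f,r\ge0$, $\Delta\ge1$ and a real $c>0$, there are $\varepsilon\in(0,1]$ and $n_0$ such that the following holds for all $n>n_0$. Suppose that - $(A,\mathcal X)$ is a rooted linear $k$-graph with $r+f$ vertices, $r$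 of which are roots; - $\ell\ge\mathrm{degen}(A,\mathcal X)$ is an integer, where $\ell\ge1$ if some edge of $A$ contains a root; - $p\in[0,1]$ and $H$ is a $(p,\varepsilon p^\ell,\varepsilon)$-pseudo-random $k$-graph on $n$ vertices with $\Delta_2(H)<\varepsilon pn^{k-1}$; - $Y\subseteq V(H)$ satisfies $200\Delta^2(r+f)^2|Y|\le n$ and $\deg_H(v;V(H)\setminus Y)>cpn^{k-1}$ for all $v\in Y$; - $T$ is an ordered $r$-graph on the vertex set $V_T=Y$ with $\Delta_1(T)\le\Delta$. Then there exists a $T$-compatible family of rooted copies of $(A,\mathcal X)$ in $H$. -/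

import Mathlib

/-- A `k`-uniform hypergraph on the vertex set `V`: every edge is a `k`-element subset of `V`. -/
structure KGraph (k : ℕ) (V : Type*) where
  edges : Finset (Finset V)
  uniform : ∀ e ∈ edges, e.card = k

namespace KGraph

variable {k : ℕ} {V : Type*} [DecidableEq V]

/-- Linear: two distinct edges share at most one vertex. -/
def IsLinear (H : KGraph k V) : Prop :=
  ∀ e ∈ H.edges, ∀ e' ∈ H.edges, e ≠ e' → (e ∩ e').card ≤ 1

/-- `e(A₁, …, A_k)`: the number of tuples `(a₁, …, a_k)`, `aᵢ ∈ Aᵢ`, which form an edge. -/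
def edgeCount (H : KGraph k V) (A : Fin k → Finset V) : ℕ :=
  ((Fintype.piFinset A).filter fun a => Finset.univ.image a ∈ H.edges).card

/-- `deg(v; U) = e({v}, U, …, U)`. It counts labelled edges: an edge consisting of `v` and `k - 1`
vertices of `U` (`v ∉ U`) is counted `(k - 1)!` times. -/
def degInto (H : KGraph k V) (v : V) (U : Finset V) : ℕ :=
  H.edgeCount fun i => if i.val = 0 then {v} else U

/-- `Δ₂(H)`: the maximum over pairs `u ≠ v` of the number of edges containing both `u` and `v`. -/
def maxCodegree [Fintype V] (H : KGraph k V) : ℕ :=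
  (Finset.univ : Finset V).offDiag.sup fun q =>
    (H.edges.filter fun e => q.1 ∈ e ∧ q.2 ∈ e).card

/-- `(p, α, ε)`-pseudo-randomness: `e(A₁, …, A_k) = (1 ± ε) p |A₁| ⋯ |A_k|` whenever
`|A₁| ⋯ |A_k| ≥ α |V| ^ k`. -/
def IsPseudoRandom [Fintype V] (H : KGraph k V) (p α ε : ℝ) : Prop :=
  ∀ A : Fin k → Finset V,
    α * (Fintype.card V : ℝ) ^ k ≤ ∏ i, ((A i).card : ℝ) →
      (1 - ε) * p * ∏ i, ((A i).card : ℝ) ≤ (H.edgeCount A : ℝ) ∧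
      (H.edgeCount A : ℝ) ≤ (1 + ε) * p * ∏ i, ((A i).card : ℝ)

end KGraph

/-- A rooted `k`-graph on the vertex set `W` with the tuple `root` of `r` distinct roots: an edge
containing a root is disjoint from every edge containing a different root. -/
structure RootedKGraph (k r : ℕ) (W : Type*) where
  graph : KGraph k W
  root : Fin r ↪ W
  disjoint_of_root_mem : ∀ i j, i ≠ j → ∀ e ∈ graph.edges, ∀ e' ∈ graph.edges,
    root i ∈ e → root j ∈ e' → Disjoint e e'

namespace RootedKGraph

variable {k r : ℕ} {W : Type*}

/-- The vertex set `e` contains a root. -/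
def ContainsRoot (A : RootedKGraph k r W) (e : Finset W) : Prop :=
  ∃ i, A.root i ∈ e

/-- An enumeration `σ` of the edges is an (admissible) edge exposure if all edges containing a root
come before all edges containing no root. -/
def IsEdgeExposure (A : RootedKGraph k r W) (σ : Fin A.graph.edges.card ≃ A.graph.edges) : Prop :=
  ∀ i j, j < i → A.ContainsRoot (σ i : Finset W) → A.ContainsRoot (σ j : Finset W)

/-- The edge-degree of the `i`-th edge in the subgraph formed by the edges exposed up to it: the
number of edges exposed earlier which intersect it. -/
def exposedDegree [DecidableEq W] (A : RootedKGraph k r W)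
    (σ : Fin A.graph.edges.card ≃ A.graph.edges) (i : Fin A.graph.edges.card) : ℕ :=
  (Finset.univ.filter fun j => j < i ∧ ¬ Disjoint (σ j : Finset W) (σ i : Finset W)).card

/-- Edge degeneracy `degen(A, 𝒳)`: the least `d` for which some edge exposure has all its exposed
edge-degrees at most `d`. -/
noncomputable def degen [DecidableEq W] (A : RootedKGraph k r W) : ℕ :=
  sInf {d | ∃ σ, A.IsEdgeExposure σ ∧ ∀ i, A.exposedDegree σ i ≤ d}

theorem exists_isEdgeExposure (A : RootedKGraph k r W) : ∃ σ, A.IsEdgeExposure σ := by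
  classical
  let g : Fin A.graph.edges.card ≃ A.graph.edges := A.graph.edges.equivFin.symm
  let f : Fin A.graph.edges.card → ℕ := fun i =>
    if A.ContainsRoot (g i : Finset W) then 0 else 1
  refine ⟨(Tuple.sort f).trans g, fun i j hji hi => ?_⟩
  have h := Tuple.monotone_sort f hji.le
  by_contra hj
  simp only [Equiv.trans_apply] at hi hj
  simp [f, hi, hj] at h

/-- The infimum in the definition of `degen` is attained. -/
theorem degen_spec [DecidableEq W] (A : RootedKGraph k r W) :
    ∃ σ, A.IsEdgeExposure σ ∧ ∀ i, A.exposedDegree σ i ≤ A.degen := by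
  obtain ⟨σ, hσ⟩ := A.exists_isEdgeExposure
  exact Nat.sInf_mem (s := {d | ∃ σ, A.IsEdgeExposure σ ∧ ∀ i, A.exposedDegree σ i ≤ d})
    ⟨Finset.univ.sup (A.exposedDegree σ), σ, hσ, fun i => Finset.le_sup (Finset.mem_univ i)⟩

/-- `φ` is a rooted copy of `(A, (x₁, …, x_r))` in `(H, (y₁, …, y_r), U)`: an edge preserving
injection with `φ xᵢ = yᵢ` that maps all non-root vertices into `U`. -/
def IsRootedCopy {V : Type*} (A : RootedKGraph k r W) (H : KGraph k V) (y : Fin r → V)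
    (U : Finset V) (φ : W ↪ V) : Prop :=
  (∀ e ∈ A.graph.edges, e.map φ ∈ H.edges) ∧
  (∀ i, φ (A.root i) = y i) ∧
  ∀ w, w ∉ Set.range A.root → φ w ∈ U

end RootedKGraph

/-- An ordered (labelled) `r`-graph with vertices in `V`: every edge is an `r`-set of vertices
together with an ordering of it, i.e. an injective `r`-tuple. -/
structure OrderedGraph (r : ℕ) (V : Type*) where
  verts : Finset V
  edges : Finset (Fin r ↪ V)
  mem_verts : ∀ e ∈ edges, ∀ i, e i ∈ verts

namespace OrderedGraph

variable {r : ℕ} {V : Type*} [DecidableEq V]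

/-- `Δ₁(T)`: the maximum number of edges of `T` containing a given vertex. -/
def maxDegree (T : OrderedGraph r V) : ℕ :=
  T.verts.sup fun v => (T.edges.filter fun e => v ∈ Finset.univ.map e).card

/-- `{A_e}_{e ∈ E(T)}`, with `A_e` the image of `φ e`, is a `T`-compatible family of copies of
`(A, 𝒳)` in `H`. -/
def IsCompatibleFamily {k : ℕ} {W : Type*} [Fintype W] [Fintype V] (T : OrderedGraph r V)
    (A : RootedKGraph k r W) (H : KGraph k V) (φ : T.edges → (W ↪ V)) : Prop :=
  (∀ e : T.edges, A.IsRootedCopy H (e : Fin r ↪ V) Finset.univ (φ e)) ∧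
  (∀ e : T.edges,
    Finset.univ.map (φ e) ∩ T.verts = Finset.univ.map (e : Fin r ↪ V)) ∧
  ∀ e e' : T.edges, e ≠ e' →
    Finset.univ.map (φ e) ∩ Finset.univ.map (φ e') =
      Finset.univ.map (e : Fin r ↪ V) ∩ Finset.univ.map (e' : Fin r ↪ V)

end OrderedGraph

/-! A single copy is found by counting. Expose the edges of `A` in an order realising the degeneracy
and treat each as a constraint on a uniformly random map `W → V`. An edge at a root constrains only
its non-root vertices; by linearity and the condition on roots these constraints have disjoint
supports, so they are independent, each of probability of order `p`. Any other edge meets each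
earlier edge in at most one vertex. Once the images outside it are fixed, the earlier constraints
confine its vertices to a product of candidate sets, and pseudo-randomness makes it an edge of `H`
on a proportion about `p` of that product, up to an error of order `ε p^(ℓ+1)`. This error is paid
only for outside assignments satisfying the earlier constraints that do not meet the edge. At most
`ℓ` earlier ones meet it, so among `t` earlier constraints at least `t - ℓ` remain, such assignments
have proportion `O(p^(t-ℓ))` (`count_le`), and the error is `O(ε p^(t+1))`, negligible against a
main term of order `p^(t+1)`. Hence some injective map satisfies everything (`le_injCount`,
`exists_isRootedCopy`), provided the roots lying in edges have degree of order `p n^(k-1)` into the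
target set.

A whole family cannot simply be chosen greedily in `V ∖ Y`: the copies may use a constant proportion
of `V`, which can exhaust a root's degree when `p` is small. But into any set of at least `n/4`
vertices only `O(ε p n)` vertices have low degree (`card_low_degree_le`), so only that many edges of
`T` are bad for the set. Split `V ∖ Y` into `U₁` and `U₂`. The edges bad for `U₂` are embedded in `V
∖ Y` by the degree hypothesis. Then `U₁` is filled greedily; what is left over is bad for the unused
part of `U₁`, so there is little of it. It is embedded in `U₂`, where only `O(ε p n)` vertices are
ever occupied, too few to spoil the degrees (`exists_pairwiseDisjoint_copies`). -/

namespace RootedEmbedding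

open Finset

set_option linter.unusedSectionVars false

/-! ### Counting maps: resampling and marginals -/

section Maps

variable {W V : Type*} [Fintype W] [DecidableEq W] [Fintype V]

open Classical in
/-- The number of maps `W → V` with the property `P`. -/
noncomputable def numMaps (P : (W → V) → Prop) : ℕ :=
  (univ.filter P).card

theorem numMaps_eq (P : (W → V) → Prop) [DecidablePred P] :
    numMaps P = (univ.filter P).card := by
  unfold numMaps
  congr

theorem numMaps_mono {P Q : (W → V) → Prop} (h : ∀ φ, P φ → Q φ) : numMaps P ≤ numMaps Q := by
  classical
  rw [numMaps_eq, numMaps_eq]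
  exact card_le_card (monotone_filter_right _ fun φ _ => h φ)

theorem numMaps_congr {P Q : (W → V) → Prop} (h : ∀ φ, P φ ↔ Q φ) : numMaps P = numMaps Q :=
  le_antisymm (numMaps_mono fun φ => (h φ).1) (numMaps_mono fun φ => (h φ).2)

theorem numMaps_true : numMaps (fun _ : W → V => True) = Fintype.card V ^ Fintype.card W := by
  classical
  rw [numMaps_eq]
  simp

/-- Resampling the coordinates in `S`. -/
theorem pow_mul_numMaps (S : Finset W) (P : (W → V) → Prop) :
    Fintype.card V ^ Fintype.card W * numMaps P =
      ∑ φ : W → V, numMaps fun ψ : W → V => P (S.piecewise ψ φ) := by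
  classical
  have h1 : Fintype.card V ^ Fintype.card W * numMaps P =
      ((univ : Finset ((W → V) × (W → V))).filter fun q => P q.1).card := by
    have h : ((univ : Finset ((W → V) × (W → V))).filter fun q => P q.1) =
        (univ.filter P) ×ˢ univ := by
      ext q
      simp
    rw [h, numMaps_eq, mul_comm, card_product]
    simp
  have h2 : ∑ φ : W → V, numMaps (fun ψ : W → V => P (S.piecewise ψ φ)) =
      ((univ : Finset ((W → V) × (W → V))).filter fun q => P (S.piecewise q.2 q.1)).card := by
    simp only [numMaps_eq, card_filter, Fintype.sum_prod_type]
  rw [h1, h2]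
  -- Exchanging the `S`-coordinates of a pair of maps is an involution.
  have hinv : ∀ q : (W → V) × (W → V),
      (S.piecewise (S.piecewise q.1 q.2) (S.piecewise q.2 q.1) = q.1) ∧
      (S.piecewise (S.piecewise q.2 q.1) (S.piecewise q.1 q.2) = q.2) := by
    intro q
    constructor <;> ext w <;> by_cases hw : w ∈ S <;> simp [hw]
  refine card_nbij' (fun q => (S.piecewise q.2 q.1, S.piecewise q.1 q.2))
    (fun q => (S.piecewise q.2 q.1, S.piecewise q.1 q.2)) ?_ ?_ ?_ ?_
  · intro q hq
    simpa [(hinv q).1] using hq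
  · intro q hq
    simpa using hq
  · intro q _
    exact Prod.ext (hinv q).1 (hinv q).2
  · intro q _
    exact Prod.ext (hinv q).1 (hinv q).2

/-- A uniform map restricts to a uniform tuple on the coordinates `b`. The bijection trades these
coordinates for an independent tuple, and the form without division keeps everything in `ℕ`. -/
theorem numMaps_comp {ι : Type*} [Fintype ι] [DecidableEq ι] (b : ι ↪ W)
    (Q : Finset (ι → V)) :
    numMaps (fun ψ : W → V => ψ ∘ b ∈ Q) * Fintype.card V ^ Fintype.card ι =
      Q.card * Fintype.card V ^ Fintype.card W := by
  classical
  have h1 : numMaps (fun ψ : W → V => ψ ∘ b ∈ Q) * Fintype.card V ^ Fintype.card ι =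
      ((univ.filter fun ψ : W → V => ψ ∘ b ∈ Q) ×ˢ (univ : Finset (ι → V))).card := by
    rw [numMaps_eq, card_product]
    simp
  have h2 : Q.card * Fintype.card V ^ Fintype.card W =
      (Q ×ˢ (univ : Finset (W → V))).card := by
    rw [card_product]
    simp
  have hext : ∀ (q q' : ι → V) (ψ : W → V),
      Function.extend b q (Function.extend b q' ψ) = Function.extend b q ψ := by
    intro q q' ψ
    ext w
    by_cases hw : ∃ i, b i = w
    · obtain ⟨i, rfl⟩ := hw
      simp [b.injective.extend_apply]
    · simp [Function.extend_apply' _ _ _ hw]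
  have hself : ∀ ψ : W → V, Function.extend b (ψ ∘ b) ψ = ψ := by
    intro ψ
    ext w
    by_cases hw : ∃ i, b i = w
    · obtain ⟨i, rfl⟩ := hw
      simp [b.injective.extend_apply]
    · simp [Function.extend_apply' _ _ _ hw]
  have hcomp : ∀ (q : ι → V) (ψ : W → V), Function.extend b q ψ ∘ b = q := by
    intro q ψ
    ext i
    simp [b.injective.extend_apply]
  rw [h1, h2]
  refine card_nbij' (fun x => (x.1 ∘ b, Function.extend b x.2 x.1))
    (fun y => (Function.extend b y.1 y.2, y.2 ∘ b)) ?_ ?_ ?_ ?_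
  · intro x hx
    simpa using hx
  · intro y hy
    simpa [hcomp] using hy
  · intro x _
    simp [hcomp, hext, hself]
  · intro y _
    simp [hcomp, hext, hself]

end Maps

/-! ### Pseudo-randomness for boxes of arbitrary size -/

section PseudoRandom

variable {W V : Type*} [Fintype W] [DecidableEq W] [Fintype V] [DecidableEq V] {k : ℕ}

theorem edgeCount_mono (H : KGraph k V) {A B : Fin k → Finset V} (h : ∀ i, A i ⊆ B i) :
    H.edgeCount A ≤ H.edgeCount B :=
  card_le_card (filter_subset_filter _ (Fintype.piFinset_subset _ _ h))

/-- Adding one vertex to one nonempty set at most doubles the product, so growing the box vertex by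
vertex cannot jump over the interval `[x, 2x]`. -/
theorem exists_superset_prod_card {A : Fin k → Finset V} (hA : ∀ i, (A i).Nonempty) {x : ℝ}
    (hx : x ≤ (Fintype.card V : ℝ) ^ k) (hAx : ∏ i, ((A i).card : ℝ) < x) :
    ∃ B : Fin k → Finset V, (∀ i, A i ⊆ B i) ∧ x ≤ ∏ i, ((B i).card : ℝ) ∧
      ∏ i, ((B i).card : ℝ) ≤ 2 * x := by
  classical
  induction hd : ∑ i, (A i)ᶜ.card using Nat.strong_induction_on generalizing A with
  | _ d ih =>
    have hne : ∃ i v, v ∉ A i := by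
      by_contra! hcon
      have : ∏ i, ((A i).card : ℝ) = (Fintype.card V : ℝ) ^ k := by
        have : ∀ i, (A i).card = Fintype.card V := fun i => by
          rw [← card_univ]
          congr 1
          exact eq_univ_iff_forall.2 (hcon i)
        simp [this]
      linarith
    obtain ⟨i, v, hv⟩ := hne
    set A' : Fin k → Finset V := Function.update A i (insert v (A i)) with hA'
    have hsub : ∀ j, A j ⊆ A' j := by
      intro j
      by_cases hj : j = i
      · subst hj
        simp [hA']
      · simp [hA', hj]
    have hcard : ∏ j, ((A' j).card : ℝ) ≤ 2 * ∏ j, ((A j).card : ℝ) := by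
      rw [← mul_prod_erase univ _ (mem_univ i),
        ← mul_prod_erase univ (fun j => ((A j).card : ℝ)) (mem_univ i), ← mul_assoc]
      have hrest : ∏ j ∈ univ.erase i, ((A' j).card : ℝ) = ∏ j ∈ univ.erase i, ((A j).card : ℝ) :=
        prod_congr rfl fun j hj => by simp [hA', ne_of_mem_erase hj]
      rw [hrest]
      refine mul_le_mul_of_nonneg_right ?_ (prod_nonneg fun j _ => Nat.cast_nonneg _)
      have h1 : (A' i).card = (A i).card + 1 := by simp [hA', hv]
      have h2 : 1 ≤ (A i).card := (hA i).card_pos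
      rw [h1]
      have h3 : (1 : ℝ) ≤ (A i).card := by exact_mod_cast h2
      push_cast
      linarith
    by_cases hge : x ≤ ∏ j, ((A' j).card : ℝ)
    · exact ⟨A', hsub, hge, by linarith⟩
    · push Not at hge
      have hlt : ∑ j, (A' j)ᶜ.card < d := by
        rw [← hd]
        refine sum_lt_sum (fun j _ => card_le_card (compl_subset_compl.2 (hsub j)))
          ⟨i, mem_univ i, ?_⟩
        refine card_lt_card ⟨compl_subset_compl.2 (hsub i), fun h => ?_⟩
        have := h (mem_compl.2 hv)
        simp [hA'] at this
      obtain ⟨B, hB, hB'⟩ := ih _ hlt (fun j => (hA j).mono (hsub j)) hge rfl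
      exact ⟨B, fun j => (hsub j).trans (hB j), hB'⟩

/-- A box below the threshold is enlarged to one of size between `α n^k` and `2 α n^k`, where
pseudo-randomness applies; this is the additive error. -/
theorem edgeCount_le_of_isPseudoRandom {H : KGraph k V} {p α ε : ℝ} (hp : 0 ≤ p) (hα : α ≤ 1)
    (hα0 : 0 ≤ α) (hε : 0 ≤ ε) (hH : H.IsPseudoRandom p α ε) (A : Fin k → Finset V) :
    (H.edgeCount A : ℝ) ≤
      (1 + ε) * p * (∏ i, ((A i).card : ℝ) + 2 * (α * (Fintype.card V : ℝ) ^ k)) := by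
  have hpos : 0 ≤ α * (Fintype.card V : ℝ) ^ k := by positivity
  have hprod : 0 ≤ ∏ i, ((A i).card : ℝ) := by positivity
  have hc : 0 ≤ (1 + ε) * p := by positivity
  by_cases hge : α * (Fintype.card V : ℝ) ^ k ≤ ∏ i, ((A i).card : ℝ)
  · exact (hH A hge).2.trans (mul_le_mul_of_nonneg_left (by linarith) hc)
  · push Not at hge
    by_cases hne : ∀ i, (A i).Nonempty
    · obtain ⟨B, hAB, hB1, hB2⟩ := exists_superset_prod_card hne
        (mul_le_of_le_one_left (by positivity) hα) hge
      calc (H.edgeCount A : ℝ) ≤ H.edgeCount B := by exact_mod_cast edgeCount_mono H hAB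
        _ ≤ _ := (hH B hB1).2
        _ ≤ _ := mul_le_mul_of_nonneg_left (by linarith) hc
    · push Not at hne
      obtain ⟨i, hi⟩ := hne
      have : H.edgeCount A = 0 := by
        unfold KGraph.edgeCount
        rw [card_eq_zero, filter_eq_empty_iff]
        intro a ha
        have := Fintype.mem_piFinset.1 ha i
        simp [hi] at this
      rw [this, Nat.cast_zero]
      positivity

theorem le_edgeCount_of_isPseudoRandom {H : KGraph k V} {p α ε : ℝ} (hp : 0 ≤ p) (hα0 : 0 ≤ α)
    (hε : ε ≤ 1) (hH : H.IsPseudoRandom p α ε) (A : Fin k → Finset V) :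
    (1 - ε) * p * (∏ i, ((A i).card : ℝ) - α * (Fintype.card V : ℝ) ^ k) ≤
      (H.edgeCount A : ℝ) := by
  have hc : 0 ≤ (1 - ε) * p := mul_nonneg (by linarith) hp
  by_cases hge : α * (Fintype.card V : ℝ) ^ k ≤ ∏ i, ((A i).card : ℝ)
  · have hα : 0 ≤ α * (Fintype.card V : ℝ) ^ k := by positivity
    exact (mul_le_mul_of_nonneg_left (by linarith) hc).trans (hH A hge).1
  · push Not at hge
    exact (mul_nonpos_of_nonneg_of_nonpos hc (by linarith)).trans (Nat.cast_nonneg _)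

theorem exists_embedding_range {S : Finset W} (hS : S.card = k) :
    ∃ b : Fin k ↪ W, univ.map b = S := by
  classical
  let e : Fin k ≃ S := (S.equivFinOfCardEq hS).symm
  refine ⟨e.toEmbedding.trans (Function.Embedding.subtype _), ?_⟩
  ext w
  constructor
  · intro hw
    obtain ⟨i, -, rfl⟩ := mem_map.1 hw
    exact (e i).2
  · intro hw
    exact mem_map.2 ⟨e.symm ⟨w, hw⟩, mem_univ _, by simp⟩

theorem numMaps_boxes {S : Finset W} (b : Fin k ↪ W) (hb : univ.map b = S) (C : W → Finset V) :
    (numMaps fun ψ : W → V => ∀ v ∈ S, ψ v ∈ C v) * Fintype.card V ^ k =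
      (∏ i, (C (b i)).card) * Fintype.card V ^ Fintype.card W := by
  have h := numMaps_comp (V := V) b (Fintype.piFinset fun i => C (b i))
  rw [Fintype.card_fin, Fintype.card_piFinset] at h
  rw [← h]
  congr 1
  refine numMaps_congr fun ψ => ?_
  subst hb
  simp

theorem numMaps_edge_boxes (H : KGraph k V) {S : Finset W} (b : Fin k ↪ W) (hb : univ.map b = S)
    (C : W → Finset V) :
    (numMaps fun ψ : W → V => (∀ v ∈ S, ψ v ∈ C v) ∧ S.image ψ ∈ H.edges) *
      Fintype.card V ^ k =
      H.edgeCount (fun i => C (b i)) * Fintype.card V ^ Fintype.card W := by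
  have h := numMaps_comp (V := V) b
    ((Fintype.piFinset fun i => C (b i)).filter fun a => univ.image a ∈ H.edges)
  rw [Fintype.card_fin] at h
  rw [KGraph.edgeCount, ← h]
  congr 1
  refine numMaps_congr fun ψ => ?_
  subst hb
  simp [map_eq_image, image_image]

theorem numMaps_edge_le {H : KGraph k V} {p α ε : ℝ} (hp : 0 ≤ p) (hα : α ≤ 1)
    (hα0 : 0 ≤ α) (hε : 0 ≤ ε) (hH : H.IsPseudoRandom p α ε) (hn : 0 < Fintype.card V)
    {S : Finset W} (hS : S.card = k) (C : W → Finset V) :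
    (numMaps (fun ψ : W → V => (∀ v ∈ S, ψ v ∈ C v) ∧ S.image ψ ∈ H.edges) : ℝ) ≤
      (1 + ε) * p * (numMaps (fun ψ : W → V => ∀ v ∈ S, ψ v ∈ C v) +
        2 * (α * (Fintype.card V : ℝ) ^ Fintype.card W)) := by
  obtain ⟨b, hb⟩ := exists_embedding_range hS
  have h1 := congrArg (Nat.cast (R := ℝ)) (numMaps_boxes b hb C)
  have h2 := congrArg (Nat.cast (R := ℝ)) (numMaps_edge_boxes H b hb C)
  push_cast at h1 h2
  have hn' : (0 : ℝ) < (Fintype.card V : ℝ) ^ k := by positivity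
  refine le_of_mul_le_mul_right ?_ hn'
  rw [h2, mul_assoc ((1 + ε) * p), add_mul (numMaps _ : ℝ), h1]
  calc _ ≤ (1 + ε) * p * (∏ i, ((C (b i)).card : ℝ) + 2 * (α * (Fintype.card V : ℝ) ^ k)) *
        (Fintype.card V : ℝ) ^ Fintype.card W := by
        gcongr
        exact edgeCount_le_of_isPseudoRandom hp hα hα0 hε hH _
    _ = _ := by ring

theorem le_numMaps_edge {H : KGraph k V} {p α ε : ℝ} (hp : 0 ≤ p) (hα0 : 0 ≤ α)
    (hε : ε ≤ 1) (hH : H.IsPseudoRandom p α ε) (hn : 0 < Fintype.card V)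
    {S : Finset W} (hS : S.card = k) (C : W → Finset V) :
    (1 - ε) * p * (numMaps (fun ψ : W → V => ∀ v ∈ S, ψ v ∈ C v) -
        α * (Fintype.card V : ℝ) ^ Fintype.card W) ≤
    (numMaps (fun ψ : W → V => (∀ v ∈ S, ψ v ∈ C v) ∧ S.image ψ ∈ H.edges) : ℝ) := by
  obtain ⟨b, hb⟩ := exists_embedding_range hS
  have h1 := congrArg (Nat.cast (R := ℝ)) (numMaps_boxes b hb C)
  have h2 := congrArg (Nat.cast (R := ℝ)) (numMaps_edge_boxes H b hb C)
  push_cast at h1 h2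
  have hn' : (0 : ℝ) < (Fintype.card V : ℝ) ^ k := by positivity
  refine le_of_mul_le_mul_right ?_ hn'
  rw [h2, mul_assoc ((1 - ε) * p), sub_mul (numMaps _ : ℝ), h1]
  calc _ = (1 - ε) * p * (∏ i, ((C (b i)).card : ℝ) - α * (Fintype.card V : ℝ) ^ k) *
        (Fintype.card V : ℝ) ^ Fintype.card W := by ring
    _ ≤ _ := by
        gcongr
        exact le_edgeCount_of_isPseudoRandom hp hα0 hε hH _

end PseudoRandom

/-! ### Counting solutions of constraint systems -/

section ConstraintSystems

variable {W V : Type*} [Fintype W] [DecidableEq W] [Fintype V] [DecidableEq V] {k m ℓ : ℕ}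

theorem sum_numMaps_and (Q : (W → V) → Prop) [DecidablePred Q] (R : (W → V) → (W → V) → Prop) :
    ∑ φ : W → V, numMaps (fun ψ => Q φ ∧ R φ ψ) = ∑ φ ∈ univ.filter Q, numMaps (R φ) := by
  rw [sum_filter]
  refine sum_congr rfl fun φ _ => ?_
  by_cases h : Q φ
  · simp [h]
  · classical
    simp [h, numMaps_eq]

/-- A sequence of constraints on maps `W → V`. Root constraints are independent of each other, and
each free constraint asks for an edge of `H` and meets at most `ℓ` earlier constraints, each in a
single vertex. -/
structure ConstraintSystem (H : KGraph k V) (W : Type*) [DecidableEq W] (m ℓ : ℕ) where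
  supp : Fin m → Finset W
  holds : Fin m → (W → V) → Prop
  IsRoot : Fin m → Prop
  holds_of_eqOn : ∀ i φ ψ, (∀ w ∈ supp i, φ w = ψ w) → holds i φ → holds i ψ
  disjoint_of_isRoot : ∀ i j, j < i → IsRoot i → Disjoint (supp j) (supp i)
  injOn_of_isRoot : ∀ i φ, IsRoot i → holds i φ → Set.InjOn φ (supp i)
  card_supp : ∀ i, ¬ IsRoot i → (supp i).card = k
  holds_iff : ∀ i φ, ¬ IsRoot i → (holds i φ ↔ (supp i).image φ ∈ H.edges)
  card_inter_le : ∀ i j, j < i → ¬ IsRoot i → (supp j ∩ supp i).card ≤ 1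
  card_touching_le : ∀ i, ¬ IsRoot i →
    (univ.filter fun j => j < i ∧ ¬ Disjoint (supp j) (supp i)).card ≤ ℓ

namespace ConstraintSystem

variable {H : KGraph k V} (Γ : ConstraintSystem H W m ℓ)

theorem holds_congr {i : Fin m} {φ ψ : W → V} (h : ∀ w ∈ Γ.supp i, φ w = ψ w) :
    Γ.holds i φ ↔ Γ.holds i ψ :=
  ⟨Γ.holds_of_eqOn i φ ψ h, Γ.holds_of_eqOn i ψ φ fun w hw => (h w hw).symm⟩

theorem holds_piecewise_of_disjoint {j : Fin m} {S : Finset W} (h : Disjoint (Γ.supp j) S)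
    (φ ψ : W → V) : Γ.holds j (S.piecewise ψ φ) ↔ Γ.holds j φ :=
  Γ.holds_congr fun _ hw => piecewise_eq_of_notMem _ _ _ (disjoint_left.1 h hw)

theorem holds_piecewise_self (i : Fin m) (φ ψ : W → V) :
    Γ.holds i ((Γ.supp i).piecewise ψ φ) ↔ Γ.holds i ψ :=
  Γ.holds_congr fun _ hw => piecewise_eq_of_mem _ _ _ hw

theorem holds_piecewise_of_card_inter {j : Fin m} {S : Finset W} {v : W} (hv : v ∈ S)
    (hvj : v ∈ Γ.supp j) (h : (Γ.supp j ∩ S).card ≤ 1) (φ ψ : W → V) :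
    Γ.holds j (S.piecewise ψ φ) ↔ Γ.holds j (Function.update φ v (ψ v)) := by
  refine Γ.holds_congr fun w hw => ?_
  by_cases hwv : w = v
  · subst hwv
    simp [hv]
  · have hwS : w ∉ S := fun hwS => hwv
      (card_le_one.1 h w (mem_inter.2 ⟨hw, hwS⟩) v (mem_inter.2 ⟨hvj, hv⟩))
    simp [hwS, hwv]

/-- The constraints of `T` whose support is disjoint from that of `i`. -/
def untouched (i : Fin m) (T : Finset (Fin m)) : Finset (Fin m) :=
  T.filter fun j => Disjoint (Γ.supp j) (Γ.supp i)

open Classical in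
/-- The images of `v` which, given the images of the other vertices, satisfy the constraints of `T`
on `v`. -/
noncomputable def cand (T : Finset (Fin m)) (φ : W → V) (v : W) : Finset V :=
  univ.filter fun a => ∀ j ∈ T, v ∈ Γ.supp j → Γ.holds j (Function.update φ v a)

theorem mem_cand {T : Finset (Fin m)} {φ : W → V} {v : W} {a : V} :
    a ∈ Γ.cand T φ v ↔ ∀ j ∈ T, v ∈ Γ.supp j → Γ.holds j (Function.update φ v a) := by
  simp [cand]

/-- The decoupling behind the count: an earlier constraint sees at most one vertex of the support of
`i`, so for fixed `φ` the conditions on `ψ` separate into one per vertex and define a box. -/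
theorem forall_holds_piecewise_iff {i : Fin m} (hi : ¬ Γ.IsRoot i) {T : Finset (Fin m)}
    (hT : ∀ j ∈ T, j < i) (φ ψ : W → V) :
    (∀ j ∈ T, Γ.holds j ((Γ.supp i).piecewise ψ φ)) ↔
      (∀ j ∈ Γ.untouched i T, Γ.holds j φ) ∧ ∀ v ∈ Γ.supp i, ψ v ∈ Γ.cand T φ v := by
  constructor
  · intro h
    constructor
    · intro j hj
      obtain ⟨hjT, hd⟩ := mem_filter.1 hj
      exact (Γ.holds_piecewise_of_disjoint hd φ ψ).1 (h j hjT)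
    · intro v hv
      refine Γ.mem_cand.2 fun j hj hvj => ?_
      exact (Γ.holds_piecewise_of_card_inter hv hvj (Γ.card_inter_le i j (hT j hj) hi) φ ψ).1
        (h j hj)
  · rintro ⟨h1, h2⟩ j hj
    by_cases hd : Disjoint (Γ.supp j) (Γ.supp i)
    · exact (Γ.holds_piecewise_of_disjoint hd φ ψ).2 (h1 j (mem_filter.2 ⟨hj, hd⟩))
    · obtain ⟨v, hvj, hv⟩ := not_disjoint_iff.1 hd
      exact (Γ.holds_piecewise_of_card_inter hv hvj (Γ.card_inter_le i j (hT j hj) hi) φ ψ).2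
        (Γ.mem_cand.1 (h2 v hv) j hj hvj)

theorem card_le_card_untouched_add {i : Fin m} (hi : ¬ Γ.IsRoot i) {T : Finset (Fin m)}
    (hT : ∀ j ∈ T, j < i) : T.card ≤ (Γ.untouched i T).card + ℓ := by
  have h := card_filter_add_card_filter_not (s := T)
    (fun j => Disjoint (Γ.supp j) (Γ.supp i))
  have h2 : (T.filter fun j => ¬ Disjoint (Γ.supp j) (Γ.supp i)).card ≤ ℓ := by
    refine (card_le_card fun j hj => ?_).trans (Γ.card_touching_le i hi)
    obtain ⟨hjT, hd⟩ := mem_filter.1 hj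
    exact mem_filter.2 ⟨mem_univ _, hT j hjT, hd⟩
  unfold untouched
  omega

theorem untouched_of_isRoot {i : Fin m} (hi : Γ.IsRoot i) {T : Finset (Fin m)}
    (hT : ∀ j ∈ T, j < i) : Γ.untouched i T = T :=
  filter_true_of_mem fun j hj => Γ.disjoint_of_isRoot i j (hT j hj) hi

/-- The number of maps satisfying the constraints in `T`. -/
noncomputable def count (T : Finset (Fin m)) : ℕ :=
  numMaps fun φ : W → V => ∀ j ∈ T, Γ.holds j φ

/-- Disjoint supports make a root constraint independent of the earlier ones. -/
theorem count_insert_root_le {i : Fin m} (hi : Γ.IsRoot i) {T : Finset (Fin m)}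
    (hT : ∀ j ∈ T, j < i) :
    Fintype.card V ^ Fintype.card W * Γ.count (insert i T) ≤
      Γ.count T * numMaps (Γ.holds i) := by
  classical
  rw [count, pow_mul_numMaps (Γ.supp i)]
  calc _ = ∑ φ : W → V, numMaps (fun ψ : W → V => (∀ j ∈ T, Γ.holds j φ) ∧ Γ.holds i ψ) := by
        refine sum_congr rfl fun φ _ => numMaps_congr fun ψ => ?_
        simp only [mem_insert, forall_eq_or_imp, Γ.holds_piecewise_self]
        rw [and_comm]
        refine and_congr_left fun _ => forall₂_congr fun j hj => ?_
        exact Γ.holds_piecewise_of_disjoint (Γ.disjoint_of_isRoot i j (hT j hj) hi) φ ψ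
    _ = _ := by
        rw [sum_numMaps_and (fun φ => ∀ j ∈ T, Γ.holds j φ) fun _ ψ => Γ.holds i ψ, sum_const,
          smul_eq_mul, count, numMaps_eq (fun φ => ∀ j ∈ T, Γ.holds j φ)]
    _ ≤ _ := le_rfl

theorem image_piecewise_self (S : Finset W) (φ ψ : W → V) :
    S.image (S.piecewise ψ φ) = S.image ψ :=
  image_congr fun _ hw => piecewise_eq_of_mem _ _ _ hw

/-- Resample the support of `i` and apply pseudo-randomness to the box of candidates. Only those `φ`
satisfying the untouched constraints contribute, so the error carries their count instead of the
number of all maps. -/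
theorem count_insert_free_le {p α ε : ℝ} (hp : 0 ≤ p) (hα : α ≤ 1)
    (hα0 : 0 ≤ α) (hε : 0 ≤ ε) (hH : H.IsPseudoRandom p α ε) (hn : 0 < Fintype.card V)
    {i : Fin m} (hi : ¬ Γ.IsRoot i) {T : Finset (Fin m)} (hT : ∀ j ∈ T, j < i) :
    (Γ.count (insert i T) : ℝ) ≤
      (1 + ε) * p * (Γ.count T + 2 * α * Γ.count (Γ.untouched i T)) := by
  classical
  set M : ℝ := (Fintype.card V : ℝ) ^ Fintype.card W with hM
  have hMpos : 0 < M := by positivity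
  set Q : (W → V) → Prop := fun φ => ∀ j ∈ Γ.untouched i T, Γ.holds j φ with hQ
  have h1 : M * Γ.count (insert i T) = ∑ φ ∈ univ.filter Q,
      (numMaps (fun ψ : W → V => (∀ v ∈ Γ.supp i, ψ v ∈ Γ.cand T φ v) ∧
        (Γ.supp i).image ψ ∈ H.edges) : ℝ) := by
    rw [hM, count]
    norm_cast
    rw [pow_mul_numMaps (Γ.supp i), ← sum_numMaps_and Q]
    refine sum_congr rfl fun φ _ => numMaps_congr fun ψ => ?_
    simp only [mem_insert, forall_eq_or_imp, Γ.holds_iff i _ hi, image_piecewise_self]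
    rw [Γ.forall_holds_piecewise_iff hi hT]
    tauto
  have h2 : M * Γ.count T = ∑ φ ∈ univ.filter Q,
      (numMaps (fun ψ : W → V => ∀ v ∈ Γ.supp i, ψ v ∈ Γ.cand T φ v) : ℝ) := by
    rw [hM, count]
    norm_cast
    rw [pow_mul_numMaps (Γ.supp i), ← sum_numMaps_and Q]
    exact sum_congr rfl fun φ _ => numMaps_congr fun ψ => Γ.forall_holds_piecewise_iff hi hT φ ψ
  have h3 : (Γ.count (Γ.untouched i T) : ℝ) = (univ.filter Q).card := by
    rw [count, numMaps_eq]
  refine le_of_mul_le_mul_left ?_ hMpos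
  rw [h1]
  calc _ ≤ ∑ φ ∈ univ.filter Q, (1 + ε) * p *
        ((numMaps (fun ψ : W → V => ∀ v ∈ Γ.supp i, ψ v ∈ Γ.cand T φ v) : ℝ) +
          2 * (α * M)) :=
        sum_le_sum fun φ _ => numMaps_edge_le hp hα hα0 hε hH hn (Γ.card_supp i hi) _
    _ = _ := by
        rw [← mul_sum, sum_add_distrib, ← h2, sum_const, nsmul_eq_mul, h3]
        ring

/-- The factor `p^ℓ` in the pseudo-randomness threshold makes up for the at most `ℓ` constraints
that were dropped. -/
theorem error_le {p ε : ℝ} (hp : 0 ≤ p) (hp1 : p ≤ 1) (hε : 0 ≤ ε)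
    {C M x : ℝ} (hC : 1 ≤ C) (hM : 0 ≤ M) {s t : ℕ} (hst : s ≤ t) (hts : t ≤ s + ℓ)
    (hx : x ≤ C ^ s * p ^ s * M) : ε * p ^ ℓ * x ≤ ε * (C ^ t * p ^ t * M) := by
  have hC0 : 0 ≤ C := by linarith
  calc ε * p ^ ℓ * x ≤ ε * p ^ ℓ * (C ^ s * p ^ s * M) := by gcongr
    _ = ε * (C ^ s * p ^ (s + ℓ) * M) := by rw [pow_add]; ring
    _ ≤ ε * (C ^ t * p ^ t * M) := by
      have h1 : C ^ s ≤ C ^ t := pow_le_pow_right₀ hC hst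
      have h2 : p ^ (s + ℓ) ≤ p ^ t := pow_le_pow_of_le_one hp hp1 hts
      gcongr

/-- Remove the last constraint of `T`. The induction runs over all sets, not just initial segments,
because the untouched constraints form an arbitrary subset. A root constraint costs `K p`, a free
one at most `(1 + ε)(1 + 2ε) p ≤ 6 p`. -/
theorem count_le {p ε K : ℝ} (hp : 0 ≤ p) (hp1 : p ≤ 1) (hε : 0 ≤ ε) (hε1 : ε ≤ 1) (hK : 0 ≤ K)
    (hH : H.IsPseudoRandom p (ε * p ^ ℓ) ε) (hn : 0 < Fintype.card V)
    (hroot : ∀ i, Γ.IsRoot i →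
      (numMaps (Γ.holds i) : ℝ) ≤ K * p * (Fintype.card V : ℝ) ^ Fintype.card W)
    (T : Finset (Fin m)) :
    (Γ.count T : ℝ) ≤ (K + 6) ^ T.card * p ^ T.card * (Fintype.card V : ℝ) ^ Fintype.card W := by
  classical
  set M : ℝ := (Fintype.card V : ℝ) ^ Fintype.card W with hM
  have hMpos : 0 < M := by positivity
  induction T using Finset.strongInduction with
  | H T ih =>
    rcases T.eq_empty_or_nonempty with rfl | hne
    · simp [count, numMaps_true, hM]
    · set i := T.max' hne with hi
      have hiT : i ∈ T := T.max'_mem hne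
      have hlt : ∀ j ∈ T.erase i, j < i := fun j hj =>
        lt_of_le_of_ne (T.le_max' j (mem_of_mem_erase hj)) (ne_of_mem_erase hj)
      have hss : T.erase i ⊂ T := erase_ssubset hiT
      have hTi : insert i (T.erase i) = T := insert_erase hiT
      have hcard : T.card = (T.erase i).card + 1 := (card_erase_add_one hiT).symm
      have ih1 := ih _ hss
      set t := (T.erase i).card with ht
      rw [hcard]
      by_cases hr : Γ.IsRoot i
      · have h := Γ.count_insert_root_le hr hlt
        rw [hTi] at h
        have h' : M * (Γ.count T : ℝ) ≤ Γ.count (T.erase i) * numMaps (Γ.holds i) := by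
          rw [hM]
          exact_mod_cast h
        refine le_of_mul_le_mul_left ?_ hMpos
        calc M * (Γ.count T : ℝ) ≤ ((K + 6) ^ t * p ^ t * M) * (K * p * M) :=
              h'.trans (mul_le_mul ih1 (hroot i hr) (Nat.cast_nonneg _) (by positivity))
          _ ≤ ((K + 6) ^ t * p ^ t * M) * ((K + 6) * p * M) := by
              gcongr
              linarith
          _ = _ := by ring
      · have h := Γ.count_insert_free_le hp
          (mul_le_one₀ hε1 (by positivity) (pow_le_one₀ hp hp1)) (by positivity) hε hH hn hr hlt
        rw [hTi] at h
        have hsub : Γ.untouched i (T.erase i) ⊆ T.erase i := filter_subset _ _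
        have ih2 := ih _ (lt_of_le_of_lt hsub hss)
        have he := error_le hp hp1 hε (by linarith : 1 ≤ K + 6) hMpos.le (card_le_card hsub)
          (Γ.card_le_card_untouched_add hr hlt) ih2
        have hX : 0 ≤ (K + 6) ^ t * p ^ t * M := by positivity
        have he' : ε * ((K + 6) ^ t * p ^ t * M) ≤ (K + 6) ^ t * p ^ t * M :=
          mul_le_of_le_one_left hX hε1
        calc (Γ.count T : ℝ) ≤ _ := h
          _ ≤ (1 + 1) * p * (3 * ((K + 6) ^ t * p ^ t * M)) := by
              have h3 : (Γ.count (T.erase i) : ℝ) + 2 * (ε * p ^ ℓ) *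
                  Γ.count (Γ.untouched i (T.erase i)) ≤ 3 * ((K + 6) ^ t * p ^ t * M) := by
                linarith
              have : (0 : ℝ) ≤ (Γ.count (T.erase i) : ℝ) + 2 * (ε * p ^ ℓ) *
                  Γ.count (Γ.untouched i (T.erase i)) := by positivity
              gcongr
          _ = 6 * (p * ((K + 6) ^ t * p ^ t * M)) := by ring
          _ ≤ (K + 6) * (p * ((K + 6) ^ t * p ^ t * M)) := by
              gcongr
              linarith
          _ = _ := by ring

/-- The number of injective maps into `U` satisfying the constraints in `T`. -/
noncomputable def injCount (U : Finset V) (T : Finset (Fin m)) : ℕ :=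
  numMaps fun φ : W → V => Function.Injective φ ∧ (∀ w, φ w ∈ U) ∧ ∀ j ∈ T, Γ.holds j φ

/-- The restriction of `φ` to the complement of the support of `i` is injective into `U` and
satisfies the constraints of `T` which do not meet this support. -/
def IsGoodOff (U : Finset V) (i : Fin m) (T : Finset (Fin m)) (φ : W → V) : Prop :=
  Set.InjOn φ (Γ.supp i : Set W)ᶜ ∧ (∀ w ∉ Γ.supp i, φ w ∈ U) ∧
    ∀ j ∈ Γ.untouched i T, Γ.holds j φ

theorem injective_piecewise {S : Finset W} {φ ψ : W → V} (hφ : Set.InjOn φ (S : Set W)ᶜ)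
    (hψ : Set.InjOn ψ S) (hne : ∀ v ∈ S, ∀ w ∉ S, φ w ≠ ψ v) :
    Function.Injective (S.piecewise ψ φ) := by
  intro a b hab
  by_cases ha : a ∈ S <;> by_cases hb : b ∈ S <;> simp only [ha, hb, not_false_eq_true,
    piecewise_eq_of_mem, piecewise_eq_of_notMem] at hab
  · exact hψ ha hb hab
  · exact absurd hab.symm (hne a ha b hb)
  · exact absurd hab (hne b hb a ha)
  · exact hφ (by simpa using ha) (by simpa using hb) hab

/-- For fixed images off the support, `hlow` is applied with `B` the set of these images, so the new
values avoid them. -/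
theorem le_injCount_insert_root {U : Finset V} {x : ℝ} {i : Fin m} (hi : Γ.IsRoot i)
    (hlow : ∀ B : Finset V, B.card ≤ Fintype.card W →
      x * (Fintype.card V : ℝ) ^ Fintype.card W ≤
        numMaps fun ψ : W → V => Γ.holds i ψ ∧ ∀ v ∈ Γ.supp i, ψ v ∈ U \ B)
    (hx : 0 ≤ x) (hn : 0 < Fintype.card V)
    {T : Finset (Fin m)} (hT : ∀ j ∈ T, j < i) :
    x * Γ.injCount U T ≤ (Γ.injCount U (insert i T) : ℝ) := by
  classical
  set M : ℝ := (Fintype.card V : ℝ) ^ Fintype.card W with hM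
  have hMpos : 0 < M := by positivity
  have hunt := Γ.untouched_of_isRoot hi hT
  have h1 : ∑ φ ∈ univ.filter (Γ.IsGoodOff U i T),
      (numMaps (fun ψ : W → V => Γ.holds i ψ ∧
        ∀ v ∈ Γ.supp i, ψ v ∈ U \ ((Γ.supp i)ᶜ.image φ)) : ℝ) ≤
      M * Γ.injCount U (insert i T) := by
    rw [hM, injCount]
    norm_cast
    rw [pow_mul_numMaps (Γ.supp i), ← sum_numMaps_and _]
    refine sum_le_sum fun φ _ => numMaps_mono fun ψ => ?_
    rintro ⟨⟨hinj, hU, hT'⟩, hholds, hψ⟩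
    refine ⟨injective_piecewise hinj (Γ.injOn_of_isRoot i ψ hi hholds) ?_, ?_, ?_⟩
    · intro v hv w hw h
      exact (mem_sdiff.1 (hψ v hv)).2 (mem_image.2 ⟨w, mem_compl.2 hw, h⟩)
    · intro w
      by_cases hw : w ∈ Γ.supp i
      · rw [piecewise_eq_of_mem _ _ _ hw]
        exact (mem_sdiff.1 (hψ w hw)).1
      · rw [piecewise_eq_of_notMem _ _ _ hw]
        exact hU w hw
    · intro j hj
      rcases mem_insert.1 hj with rfl | hj
      · exact (Γ.holds_piecewise_self _ _ _).2 hholds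
      · refine (Γ.holds_piecewise_of_disjoint (Γ.disjoint_of_isRoot i j (hT j hj) hi) _ _).2
          (hT' j ?_)
        rwa [hunt]
  have h2 : (Γ.injCount U T : ℝ) ≤ (univ.filter (Γ.IsGoodOff U i T)).card := by
    rw [injCount, ← numMaps_eq]
    norm_cast
    refine numMaps_mono fun φ hφ => ⟨hφ.1.injOn, fun w _ => hφ.2.1 w, ?_⟩
    rw [hunt]
    exact hφ.2.2
  refine le_of_mul_le_mul_left ?_ hMpos
  refine le_trans ?_ h1
  calc M * (x * Γ.injCount U T) ≤ M * (x * (univ.filter (Γ.IsGoodOff U i T)).card) := by gcongr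
    _ = ∑ φ ∈ univ.filter (Γ.IsGoodOff U i T), x * M := by
        rw [sum_const, nsmul_eq_mul]
        ring
    _ ≤ _ := sum_le_sum fun φ _ => hlow _ (card_image_le.trans (card_le_univ _))

/-- Restricting the candidates to `U` minus the outside images still gives a box. Injectivity on the
support itself need not be imposed: an image that is an edge has `k` elements. -/
theorem le_injCount_insert_free {U : Finset V} {p α ε : ℝ} (hp : 0 ≤ p)
    (hα0 : 0 ≤ α) (hε : ε ≤ 1) (hH : H.IsPseudoRandom p α ε) (hn : 0 < Fintype.card V)
    {i : Fin m} (hi : ¬ Γ.IsRoot i) {T : Finset (Fin m)} (hT : ∀ j ∈ T, j < i) :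
    (1 - ε) * p * (Γ.injCount U T - α * Γ.count (Γ.untouched i T)) ≤
      (Γ.injCount U (insert i T) : ℝ) := by
  classical
  set M : ℝ := (Fintype.card V : ℝ) ^ Fintype.card W with hM
  have hMpos : 0 < M := by positivity
  set Q := Γ.IsGoodOff U i T with hQ
  set D : (W → V) → W → Finset V := fun φ v =>
    (Γ.cand T φ v).filter fun a => a ∈ U ∧ ∀ w ∉ Γ.supp i, φ w ≠ a with hD
  have h1 : ∑ φ ∈ univ.filter Q,
      (numMaps (fun ψ : W → V => (∀ v ∈ Γ.supp i, ψ v ∈ D φ v) ∧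
        (Γ.supp i).image ψ ∈ H.edges) : ℝ) ≤ M * Γ.injCount U (insert i T) := by
    rw [hM, injCount]
    norm_cast
    rw [pow_mul_numMaps (Γ.supp i), ← sum_numMaps_and _]
    refine sum_le_sum fun φ _ => numMaps_mono fun ψ => ?_
    rintro ⟨⟨hinj, hU, hT'⟩, hψ, hedge⟩
    refine ⟨injective_piecewise hinj ?_ ?_, ?_, ?_⟩
    · rw [← card_image_iff, H.uniform _ hedge, Γ.card_supp i hi]
    · intro v hv w hw
      exact (mem_filter.1 (hψ v hv)).2.2 w hw
    · intro w
      by_cases hw : w ∈ Γ.supp i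
      · rw [piecewise_eq_of_mem _ _ _ hw]
        exact (mem_filter.1 (hψ w hw)).2.1
      · rw [piecewise_eq_of_notMem _ _ _ hw]
        exact hU w hw
    · intro j hj
      rcases mem_insert.1 hj with rfl | hj
      · rwa [Γ.holds_iff _ _ hi, image_piecewise_self]
      · exact (Γ.forall_holds_piecewise_iff hi hT φ ψ).2
          ⟨hT', fun v hv => (mem_filter.1 (hψ v hv)).1⟩ j hj
  have h2 : M * Γ.injCount U T ≤ ∑ φ ∈ univ.filter Q,
      (numMaps (fun ψ : W → V => ∀ v ∈ Γ.supp i, ψ v ∈ D φ v) : ℝ) := by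
    rw [hM, injCount]
    norm_cast
    rw [pow_mul_numMaps (Γ.supp i), ← sum_numMaps_and _]
    refine sum_le_sum fun φ _ => numMaps_mono fun ψ => ?_
    rintro ⟨hinj, hU, hT'⟩
    obtain ⟨h3, h4⟩ := (Γ.forall_holds_piecewise_iff hi hT φ ψ).1 hT'
    refine ⟨⟨?_, ?_, h3⟩, fun v hv => mem_filter.2 ⟨h4 v hv, ?_, ?_⟩⟩
    · intro a ha b hb hab
      refine hinj ?_
      rw [piecewise_eq_of_notMem _ _ _ (by simpa using ha),
        piecewise_eq_of_notMem _ _ _ (by simpa using hb), hab]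
    · intro w hw
      have := hU w
      rwa [piecewise_eq_of_notMem _ _ _ hw] at this
    · have := hU v
      rwa [piecewise_eq_of_mem _ _ _ hv] at this
    · intro w hw h
      have : w = v := hinj (by
        rw [piecewise_eq_of_notMem _ _ _ hw, piecewise_eq_of_mem _ _ _ hv, h])
      exact hw (this ▸ hv)
  have h3 : ((univ.filter Q).card : ℝ) ≤ Γ.count (Γ.untouched i T) := by
    rw [count, ← numMaps_eq]
    norm_cast
    exact numMaps_mono fun φ hφ => hφ.2.2
  have hc : 0 ≤ (1 - ε) * p := mul_nonneg (by linarith) hp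
  refine le_of_mul_le_mul_left ?_ hMpos
  refine le_trans ?_ h1
  calc M * ((1 - ε) * p * (Γ.injCount U T - α * Γ.count (Γ.untouched i T))) =
      (1 - ε) * p * (M * Γ.injCount U T - α * M * Γ.count (Γ.untouched i T)) := by ring
    _ ≤ (1 - ε) * p * (∑ φ ∈ univ.filter Q,
        (numMaps (fun ψ : W → V => ∀ v ∈ Γ.supp i, ψ v ∈ D φ v) : ℝ) -
          α * M * (univ.filter Q).card) := by
        refine mul_le_mul_of_nonneg_left (sub_le_sub h2 ?_) hc
        gcongr
    _ = ∑ φ ∈ univ.filter Q, (1 - ε) * p *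
        ((numMaps (fun ψ : W → V => ∀ v ∈ Γ.supp i, ψ v ∈ D φ v) : ℝ) - α * M) := by
        rw [← mul_sum, sum_sub_distrib, sum_const, nsmul_eq_mul]
        ring
    _ ≤ _ := sum_le_sum fun φ _ => le_numMaps_edge hp hα0 hε hH hn (Γ.card_supp i hi) _

theorem le_injCount_empty {U : Finset V} {x : ℝ} (hx : 0 ≤ x)
    (hU : x + Fintype.card W ≤ U.card) : x ^ Fintype.card W ≤ (Γ.injCount U ∅ : ℝ) := by
  classical
  have h : Γ.injCount U ∅ = U.card.descFactorial (Fintype.card W) := by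
    rw [injCount, numMaps_eq, ← Fintype.card_subtype, ← Fintype.card_coe U,
      ← Fintype.card_embedding_eq]
    refine Fintype.card_congr
      { toFun := fun φ => ⟨fun w => ⟨φ.1 w, φ.2.2.1 w⟩, fun a b hab =>
          φ.2.1 (congrArg Subtype.val hab)⟩
        invFun := fun e => ⟨fun w => e w, fun a b hab => e.injective (Subtype.ext hab),
          fun w => (e w).2, by simp⟩
        left_inv := fun φ => rfl
        right_inv := fun e => rfl }
  rw [h]
  have h2 : (U.card + 1 - Fintype.card W) ^ Fintype.card W ≤
      U.card.descFactorial (Fintype.card W) := Nat.pow_sub_le_descFactorial _ _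
  refine le_trans ?_ (Nat.cast_le.2 h2)
  push_cast
  gcongr
  have h3 : (Fintype.card W : ℝ) ≤ U.card := by linarith
  have h4 : Fintype.card W ≤ U.card := by exact_mod_cast h3
  rw [Nat.cast_sub (by omega)]
  push_cast
  linarith

theorem le_injCount {U : Finset V} {p ε K κ : ℝ} (hp : 0 ≤ p) (hp1 : p ≤ 1) (hε : 0 ≤ ε)
    (hε1 : ε ≤ 1 / 2) (hK : 0 ≤ K) (hκ0 : 0 ≤ κ) (hκ : κ ≤ 1 / 4)
    (hεκ : 2 * ε * (K + 6) ^ m ≤ κ ^ m * (1 / 8) ^ Fintype.card W)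
    (hH : H.IsPseudoRandom p (ε * p ^ ℓ) ε) (hn : 0 < Fintype.card V)
    (hroot : ∀ i, Γ.IsRoot i →
      (numMaps (Γ.holds i) : ℝ) ≤ K * p * (Fintype.card V : ℝ) ^ Fintype.card W)
    (hlow : ∀ i, Γ.IsRoot i → ∀ B : Finset V, B.card ≤ Fintype.card W →
      κ * p * (Fintype.card V : ℝ) ^ Fintype.card W ≤
        numMaps fun ψ : W → V => Γ.holds i ψ ∧ ∀ v ∈ Γ.supp i, ψ v ∈ U \ B)
    (hU : (Fintype.card V : ℝ) / 8 + Fintype.card W ≤ U.card) {t : ℕ} (ht : t ≤ m) :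
    κ ^ t * (1 / 8) ^ Fintype.card W * (p ^ t * (Fintype.card V : ℝ) ^ Fintype.card W) ≤
      Γ.injCount U (univ.filter fun j => j.val < t) := by
  classical
  set M : ℝ := (Fintype.card V : ℝ) ^ Fintype.card W with hM
  have hMpos : 0 < M := by positivity
  induction t with
  | zero =>
    -- Applied with `x = n / 8`, which produces the factor `(1 / 8) ^ |W|`.
    have h := Γ.le_injCount_empty (by positivity) hU
    simp only [pow_zero, one_mul, not_lt_zero, filter_false]
    refine le_trans (le_of_eq ?_) h
    rw [hM, ← mul_pow]
    congr 1
    ring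
  | succ t ih =>
    have iht := ih (by omega)
    set i : Fin m := ⟨t, by omega⟩ with hi
    set T : Finset (Fin m) := univ.filter fun j => j.val < t with hT
    have hlt : ∀ j ∈ T, j < i := fun j hj => (mem_filter.1 hj).2
    have hins : (univ.filter fun j : Fin m => j.val < t + 1) = insert i T := by
      ext j
      simp only [hT, mem_filter, mem_univ, true_and, mem_insert, hi, Fin.ext_iff]
      omega
    have hcard : T.card = t := by
      rw [hT, Fin.card_filter_val_lt]
      omega
    rw [hins]
    set c : ℝ := (1 / 8) ^ Fintype.card W with hc
    have hcpos : 0 < c := by positivity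
    by_cases hr : Γ.IsRoot i
    · have h := Γ.le_injCount_insert_root hr (hlow i hr) (by positivity) hn hlt
      calc _ = κ * p * (κ ^ t * c * (p ^ t * M)) := by ring
        _ ≤ κ * p * Γ.injCount U T := by gcongr
        _ ≤ _ := h
    · have h := Γ.le_injCount_insert_free (U := U) hp (by positivity) (by linarith) hH hn hr hlt
      refine le_trans ?_ h
      have hsub : Γ.untouched i T ⊆ T := filter_subset _ _
      have he := error_le hp hp1 hε (by linarith : 1 ≤ K + 6) hMpos.le (card_le_card hsub)
          (Γ.card_le_card_untouched_add hr hlt)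
          (Γ.count_le hp hp1 hε (by linarith) hK hH hn hroot (Γ.untouched i T))
      rw [hcard] at he
      have hsmall : 2 * ε * (K + 6) ^ t ≤ κ ^ t * c := by
        have h1 : (K + 6) ^ t ≤ (K + 6) ^ m := pow_le_pow_right₀ (by linarith) (by omega)
        have h2 : κ ^ m ≤ κ ^ t := pow_le_pow_of_le_one hκ0 (by linarith) (by omega)
        calc 2 * ε * (K + 6) ^ t ≤ 2 * ε * (K + 6) ^ m := by gcongr
          _ ≤ κ ^ m * c := hεκ
          _ ≤ κ ^ t * c := by gcongr
      -- The error eats at most half of the main term; with `1 - ε ≥ 1/2` a free step then retains a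
      -- factor `p / 4 ≥ κ p`.
      have hhalf : ε * ((K + 6) ^ t * p ^ t * M) ≤ κ ^ t * c * (p ^ t * M) / 2 := by
        have : 0 ≤ p ^ t * M := by positivity
        nlinarith [mul_le_mul_of_nonneg_right hsmall this]
      have hX : 0 ≤ κ ^ t * c * (p ^ t * M) := by positivity
      have h3 : κ ^ t * c * (p ^ t * M) / 2 ≤
          Γ.injCount U T - ε * p ^ ℓ * Γ.count (Γ.untouched i T) := by linarith
      calc κ ^ (t + 1) * c * (p ^ (t + 1) * M) = κ * (p * (κ ^ t * c * (p ^ t * M))) := by ring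
        _ ≤ 1 / 4 * (p * (κ ^ t * c * (p ^ t * M))) := by gcongr
        _ = (1 - 1 / 2) * p * (κ ^ t * c * (p ^ t * M) / 2) := by ring
        _ ≤ (1 - ε) * p * (Γ.injCount U T - ε * p ^ ℓ * Γ.count (Γ.untouched i T)) := by
            have : 0 ≤ 1 - ε := by linarith
            gcongr

end ConstraintSystem

end ConstraintSystems

/-! ### Labelled edges at a vertex -/

section Link

variable {V : Type*} [Fintype V] [DecidableEq V] {k : ℕ} {H : KGraph k V}

/-- The labelled edges consisting of `v` in first position and of vertices of `U`. -/
def link (H : KGraph k V) (v : V) (U : Finset V) : Finset (Fin k → V) :=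
  (Fintype.piFinset fun i : Fin k => if i.val = 0 then {v} else U).filter
    fun a => univ.image a ∈ H.edges

theorem card_link (H : KGraph k V) (v : V) (U : Finset V) :
    (link H v U).card = H.degInto v U := rfl

theorem mem_link {v : V} {U : Finset V} {a : Fin k → V} :
    a ∈ link H v U ↔ (∀ i : Fin k, i.val = 0 → a i = v) ∧ (∀ i : Fin k, i.val ≠ 0 → a i ∈ U) ∧
      univ.image a ∈ H.edges := by
  rw [link, mem_filter, Fintype.mem_piFinset, ← and_assoc, ← forall_and]
  refine and_congr_left fun _ => forall_congr' fun i => ?_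
  by_cases hi : i.val = 0 <;> simp [hi]

theorem injective_of_image_mem {a : Fin k → V} (h : univ.image a ∈ H.edges) :
    Function.Injective a := by
  have := H.uniform _ h
  rw [← Set.injOn_univ, ← coe_univ, ← card_image_iff, this, card_univ, Fintype.card_fin]

theorem card_filter_le_maxCodegree {u v : V} (huv : u ≠ v) :
    (H.edges.filter fun e => u ∈ e ∧ v ∈ e).card ≤ H.maxCodegree :=
  le_sup (s := univ.offDiag)
    (f := fun q : V × V => (H.edges.filter fun e => q.1 ∈ e ∧ q.2 ∈ e).card) (b := (u, v))
    (mem_offDiag.2 ⟨mem_univ _, mem_univ _, huv⟩)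

theorem one_le_maxCodegree (hk : 2 ≤ k) {a : Fin k → V} (h : univ.image a ∈ H.edges) :
    1 ≤ H.maxCodegree := by
  have hne : a ⟨0, by omega⟩ ≠ a ⟨1, by omega⟩ := fun h' => by
    simpa using injective_of_image_mem h h'
  refine le_trans (card_pos.2 ⟨univ.image a, mem_filter.2 ⟨h, ?_, ?_⟩⟩)
    (card_filter_le_maxCodegree hne)
  · exact mem_image_of_mem _ (mem_univ _)
  · exact mem_image_of_mem _ (mem_univ _)

/-- Each such edge contains `v` and some `u ∈ B` with `u ≠ v`, and has at most `k^k` labellings.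
This is where the codegree hypothesis enters. -/
theorem card_link_meeting_le (hk : 2 ≤ k) {v : V} {U : Finset V} (hv : v ∉ U) (B : Finset V) :
    ((link H v U).filter fun a => ∃ i : Fin k, i.val ≠ 0 ∧ a i ∈ B).card ≤
      B.card * (H.maxCodegree * k ^ k) := by
  have hsub : ((link H v U).filter fun a => ∃ i : Fin k, i.val ≠ 0 ∧ a i ∈ B) ⊆
      (B.erase v).biUnion fun u => (H.edges.filter fun e => v ∈ e ∧ u ∈ e).biUnion
        fun e => Fintype.piFinset fun _ : Fin k => e := by
    intro a ha
    obtain ⟨ha, i, hi, hB⟩ := mem_filter.1 ha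
    obtain ⟨h0, hU, he⟩ := mem_link.1 ha
    refine mem_biUnion.2 ⟨a i, mem_erase.2 ⟨fun h => hv (h ▸ hU i hi), hB⟩, mem_biUnion.2
      ⟨univ.image a, mem_filter.2 ⟨he, ?_, mem_image_of_mem _ (mem_univ _)⟩, ?_⟩⟩
    · rw [← h0 ⟨0, by omega⟩ rfl]
      exact mem_image_of_mem _ (mem_univ _)
    · exact Fintype.mem_piFinset.2 fun j => mem_image_of_mem _ (mem_univ _)
  refine (card_le_card hsub).trans ?_
  refine (card_biUnion_le_card_mul _ _ (H.maxCodegree * k ^ k) fun u hu => ?_).trans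
    (Nat.mul_le_mul_right _ (card_le_card (erase_subset _ _)))
  refine (card_biUnion_le_card_mul _ _ (k ^ k) fun e he => ?_).trans
    (Nat.mul_le_mul_right _ (card_filter_le_maxCodegree (ne_of_mem_erase hu).symm))
  simp [H.uniform e (mem_filter.1 he).1]

theorem card_update_mem {ι : Type*} [Fintype ι] [DecidableEq ι] (L : Finset (ι → V)) (z : ι)
    (v : V) (hL : ∀ a ∈ L, a z = v) :
    ((univ : Finset (ι → V)).filter fun q => Function.update q z v ∈ L).card =
      L.card * Fintype.card V := by
  rw [← card_univ (α := V), ← card_product]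
  refine card_nbij' (fun q => (Function.update q z v, q z)) (fun x => Function.update x.1 z x.2)
    ?_ ?_ ?_ ?_
  · intro q hq
    simpa using hq
  · intro x hx
    have hx1 : x.1 ∈ L := (mem_product.1 hx).1
    have : Function.update x.1 z v = x.1 := by
      rw [← hL _ hx1, Function.update_eq_self]
    simpa [this] using hx1
  · intro q _
    simp
  · intro x hx
    have hx1 : x.1 ∈ L := (mem_product.1 hx).1
    have : Function.update x.1 z v = x.1 := by
      rw [← hL _ hx1, Function.update_eq_self]
    simp [this]

/-- The value of `φ` at `b z` is overwritten by `v`, so only `k - 1` coordinates are constrained. -/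
theorem numMaps_link {W : Type*} [Fintype W] [DecidableEq W] (hk : 2 ≤ k)
    (hn : 0 < Fintype.card V) (b : Fin k ↪ W) (z : Fin k)
    (L : Finset (Fin k → V)) (v : V) (hL : ∀ a ∈ L, a z = v) :
    numMaps (fun φ : W → V => Function.update (φ ∘ b) z v ∈ L) * Fintype.card V ^ (k - 1) =
      L.card * Fintype.card V ^ Fintype.card W := by
  have h := numMaps_comp (V := V) b
    ((univ : Finset (Fin k → V)).filter fun q => Function.update q z v ∈ L)
  rw [card_update_mem L z v hL, Fintype.card_fin] at h
  simp only [mem_filter, mem_univ, true_and] at h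
  obtain ⟨j, rfl⟩ : ∃ j, k = j + 1 := ⟨k - 1, by omega⟩
  refine Nat.eq_of_mul_eq_mul_right hn ?_
  rw [Nat.add_sub_cancel, mul_assoc, ← pow_succ, h]
  ring

end Link

/-! ### Embedding one rooted copy -/

section Rooted

variable {W V : Type*} [Fintype W] [DecidableEq W] [Fintype V] [DecidableEq V] {k r ℓ : ℕ}

theorem eq_of_root_mem {A : RootedKGraph k r W} {e : Finset W}
    (he : e ∈ A.graph.edges) {i j : Fin r} (hi : A.root i ∈ e) (hj : A.root j ∈ e) : i = j := by
  by_contra hij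
  exact disjoint_left.1 (A.disjoint_of_root_mem i j hij e he e he hi hj) hi hi

theorem exists_embedding_range_apply {S : Finset W} (hS : S.card = k) (z : Fin k) {x : W}
    (hx : x ∈ S) : ∃ b : Fin k ↪ W, univ.map b = S ∧ b z = x := by
  obtain ⟨b, hb⟩ := exists_embedding_range hS
  obtain ⟨i, -, hi⟩ := mem_map.1 (hb ▸ hx)
  refine ⟨(Equiv.swap z i).toEmbedding.trans b, ?_, by simp [hi]⟩
  rw [← map_map, map_univ_equiv, hb]

/-- The constraint system for rooted copies of `A` whose edge at the `i`-th root is taken from the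
set `L i` of labelled edges. -/
theorem exists_constraintSystem (A : RootedKGraph k r W) (H : KGraph k V)
    (hlin : A.graph.IsLinear) (hdeg : A.degen ≤ ℓ) (y : Fin r ↪ V) {U : Finset V}
    (z : Fin k) (hz : z.val = 0)
    (L : Fin r → Finset (Fin k → V)) (hL : ∀ i, L i ⊆ link H (y i) U) :
    ∃ (Γ : ConstraintSystem H W A.graph.edges.card ℓ)
      (σ : Fin A.graph.edges.card ≃ A.graph.edges),
      (∀ i, ¬ Γ.IsRoot i → ∀ j, A.root j ∉ (σ i : Finset W)) ∧
      (∀ i, ¬ Γ.IsRoot i → Γ.supp i = σ i) ∧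
      ∀ i, Γ.IsRoot i → ∃ (j : Fin r) (b : Fin k ↪ W), univ.map b = (σ i : Finset W) ∧
        b z = A.root j ∧ (Γ.supp i = univ.image fun s : {s : Fin k // s ≠ z} => b s) ∧
        (∀ s ≠ z, b s ∉ Set.range A.root) ∧
        ∀ φ, Γ.holds i φ ↔ Function.update (φ ∘ b) z (y j) ∈ L j := by
  classical
  obtain ⟨σ, hσ, hσd⟩ := A.degen_spec
  have hσE : ∀ i, (σ i : Finset W) ∈ A.graph.edges := fun i => (σ i).2
  have hρ : ∀ i, A.ContainsRoot (σ i : Finset W) → ∃ (j : Fin r) (b : Fin k ↪ W),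
      univ.map b = (σ i : Finset W) ∧ b z = A.root j := by
    rintro i ⟨j, hj⟩
    obtain ⟨b, hb⟩ := exists_embedding_range_apply (A.graph.uniform _ (hσE i)) z hj
    exact ⟨j, b, hb⟩
  choose ρ b hb hbz using hρ
  have hρE : ∀ i h, A.root (ρ i h) ∈ (σ i : Finset W) := fun i h => by
    rw [← hbz i h, ← hb i h]
    exact mem_map_of_mem _ (mem_univ _)
  have hbroot : ∀ i h, ∀ s ≠ z, b i h s ∉ Set.range A.root := by
    rintro i h s hs ⟨j, hj⟩
    have hjE : A.root j ∈ (σ i : Finset W) := by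
      rw [hj, ← hb i h]
      exact mem_map_of_mem _ (mem_univ _)
    rw [eq_of_root_mem (hσE i) hjE (hρE i h), ← hbz i h] at hj
    exact hs ((b i h).injective hj).symm
  -- Roots are removed from the supports, since their images are prescribed; this makes edges at the
  -- same root disjoint.
  set supp : Fin A.graph.edges.card → Finset W := fun i =>
    (σ i : Finset W).filter fun w => w ∉ Set.range A.root with hsupp
  have hsub : ∀ i, supp i ⊆ σ i := fun i => filter_subset _ _
  have hsupp_free : ∀ i, ¬ A.ContainsRoot (σ i : Finset W) → supp i = σ i := by
    intro i h
    refine filter_true_of_mem fun w hw => ?_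
    rintro ⟨j, rfl⟩
    exact h ⟨j, hw⟩
  have hmem : ∀ i h, ∀ s ≠ z, b i h s ∈ supp i := fun i h s hs => mem_filter.2
    ⟨by rw [← hb i h]; exact mem_map_of_mem _ (mem_univ _), hbroot i h s hs⟩
  have hsupp_root : ∀ i h, supp i = univ.image fun s : {s : Fin k // s ≠ z} => b i h s := by
    intro i h
    ext w
    constructor
    · intro hw
      obtain ⟨hw, hr⟩ := mem_filter.1 hw
      rw [← hb i h] at hw
      obtain ⟨s, -, rfl⟩ := mem_map.1 hw
      refine mem_image.2 ⟨⟨s, ?_⟩, mem_univ _, rfl⟩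
      rintro rfl
      exact hr ⟨_, (hbz i h).symm⟩
    · intro hw
      obtain ⟨s, -, rfl⟩ := mem_image.1 hw
      exact hmem i h s s.2
  have hne : ∀ i j, j < i → (σ j : Finset W) ≠ σ i := fun i j hji h =>
    hji.ne (σ.injective (Subtype.ext h))
  let Γ : ConstraintSystem H W A.graph.edges.card ℓ :=
    { supp := supp
      holds := fun i φ =>
        (∀ h, Function.update (φ ∘ b i h) z (y (ρ i h)) ∈ L (ρ i h)) ∧
          (¬ A.ContainsRoot (σ i : Finset W) → (supp i).image φ ∈ H.edges)
      IsRoot := fun i => A.ContainsRoot (σ i : Finset W)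
      holds_of_eqOn := by
        rintro i φ ψ hφψ ⟨h1, h2⟩
        refine ⟨fun h => ?_, fun h => ?_⟩
        · convert h1 h using 1
          ext s
          by_cases hs : s = z
          · subst hs
            simp
          · simp [hs, hφψ _ (hmem i h s hs)]
        · convert h2 h using 1
          exact image_congr fun w hw => (hφψ w hw).symm
      disjoint_of_isRoot := by
        intro i j hji hi
        have hj := hσ i j hji hi
        refine disjoint_left.2 fun w hwj hwi => ?_
        by_cases hij : ρ i hi = ρ j hj
        · have h1 := hlin _ (hσE j) _ (hσE i) (hne i j hji)
          have h2 := card_le_one.1 h1 w (mem_inter.2 ⟨hsub j hwj, hsub i hwi⟩) (A.root (ρ i hi))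
            (mem_inter.2 ⟨hij ▸ hρE j hj, hρE i hi⟩)
          exact (mem_filter.1 hwi).2 ⟨_, h2.symm⟩
        · exact disjoint_left.1 (A.disjoint_of_root_mem _ _ hij _ (hσE i) _ (hσE j)
            (hρE i hi) (hρE j hj)) (hsub i hwi) (hsub j hwj)
      injOn_of_isRoot := by
        rintro i φ hi ⟨h1, -⟩
        have h2 := injective_of_image_mem (mem_link.1 (hL _ (h1 hi))).2.2
        intro v hv w hw hvw
        rw [mem_coe, hsupp_root i hi, mem_image] at hv hw
        obtain ⟨s, -, rfl⟩ := hv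
        obtain ⟨t, -, rfl⟩ := hw
        have : s.1 = t.1 := h2 (by simpa [s.2, t.2] using hvw)
        simp [this]
      card_supp := fun i hi => by
        rw [hsupp_free i hi]
        exact A.graph.uniform _ (hσE i)
      holds_iff := fun i φ hi => ⟨fun h => h.2 hi, fun h => ⟨fun h' => absurd h' hi, fun _ => h⟩⟩
      card_inter_le := fun i j hji _ =>
        (card_le_card (inter_subset_inter (hsub j) (hsub i))).trans
          (hlin _ (hσE j) _ (hσE i) (hne i j hji))
      card_touching_le := fun i _ => by
        refine le_trans (card_le_card fun j hj => ?_) ((hσd i).trans hdeg)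
        obtain ⟨-, hji, hd⟩ := mem_filter.1 hj
        exact mem_filter.2 ⟨mem_univ _, hji, fun h => hd (h.mono (hsub j) (hsub i))⟩ }
  refine ⟨Γ, σ, fun i hi j hj => hi ⟨j, hj⟩, hsupp_free, fun i hi => ⟨ρ i hi, b i hi, hb i hi,
    hbz i hi, hsupp_root i hi, hbroot i hi, fun φ => ⟨fun h => h.1 hi, fun h =>
      ⟨fun _ => h, fun h' => absurd hi h'⟩⟩⟩⟩

/-- No upper bound on the degree of a root is assumed, but the upper count needs root constraints of
probability `O(p)`; hence a subset of the link is kept. -/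
theorem exists_trimmed_link {H : KGraph k V} (hk : 2 ≤ k) {p ε c : ℝ} {v : V} {U : Finset V}
    (hp : 0 < p) (hε1 : ε ≤ 1) (hc : 0 < c) (hn : 0 < Fintype.card V)
    (hcodeg : (H.maxCodegree : ℝ) < ε * p * (Fintype.card V : ℝ) ^ (k - 1))
    (hdeg : c * p * (Fintype.card V : ℝ) ^ (k - 1) ≤ H.degInto v U) :
    ∃ L ⊆ link H v U, c * p * (Fintype.card V : ℝ) ^ (k - 1) ≤ L.card ∧
      (L.card : ℝ) ≤ (c + 1) * p * (Fintype.card V : ℝ) ^ (k - 1) := by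
  have hM : (0 : ℝ) < p * (Fintype.card V : ℝ) ^ (k - 1) := by positivity
  have hx : 0 < c * p * (Fintype.card V : ℝ) ^ (k - 1) := by positivity
  obtain ⟨L, hL, hLc⟩ := exists_subset_card_eq (s := link H v U)
    (n := ⌈c * p * (Fintype.card V : ℝ) ^ (k - 1)⌉₊) (by
      rw [card_link]
      exact Nat.ceil_le.2 hdeg)
  have hpos : 0 < (link H v U).card := by
    rw [card_link]
    exact_mod_cast hx.trans_le hdeg
  obtain ⟨a, ha⟩ := card_pos.1 hpos
  -- As an edge exists, the codegree bound gives `1 < ε p n^(k-1)`, which absorbs the rounding up.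
  have h1 : (1 : ℝ) ≤ H.maxCodegree := by
    exact_mod_cast one_le_maxCodegree hk (mem_link.1 ha).2.2
  refine ⟨L, hL, ?_, ?_⟩
  · rw [hLc]
    exact Nat.le_ceil _
  · rw [hLc]
    have h2 := (Nat.ceil_lt_add_one hx.le).le
    have h3 : ε * (p * (Fintype.card V : ℝ) ^ (k - 1)) ≤ 1 * (p * (Fintype.card V : ℝ) ^ (k - 1)) :=
      mul_le_mul_of_nonneg_right hε1 hM.le
    calc _ ≤ c * p * (Fintype.card V : ℝ) ^ (k - 1) + 1 := h2
      _ ≤ _ := by linarith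

/-- A linear rooted `k`-graph embeds into a pseudo-random `k`-graph with prescribed roots of large
degree into a large set `U`, the other vertices being mapped into `U`. -/
theorem exists_isRootedCopy (A : RootedKGraph k r W) (H : KGraph k V) (hk : 2 ≤ k)
    (hlin : A.graph.IsLinear) (hdeg : A.degen ≤ ℓ) {p ε c : ℝ} (hp : 0 < p) (hp1 : p ≤ 1)
    (hε : 0 < ε) (hε1 : ε ≤ 1 / 2) (hc : 0 < c) (hc1 : c ≤ 1 / 2)
    (hεc : 2 * (Fintype.card W * k ^ k * ε) ≤ c)
    (hεκ : 2 * ε * (c + 7) ^ (2 ^ Fintype.card W) ≤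
      (c / 2) ^ (2 ^ Fintype.card W) * (1 / 8) ^ Fintype.card W)
    (hH : H.IsPseudoRandom p (ε * p ^ ℓ) ε) (hn : 0 < Fintype.card V)
    (hcodeg : (H.maxCodegree : ℝ) < ε * p * (Fintype.card V : ℝ) ^ (k - 1))
    (y : Fin r ↪ V) {U : Finset V} (hyU : ∀ i, y i ∉ U)
    (hU : (Fintype.card V : ℝ) / 8 + Fintype.card W ≤ U.card)
    (hyd : ∀ i, (∃ e ∈ A.graph.edges, A.root i ∈ e) →
      c * p * (Fintype.card V : ℝ) ^ (k - 1) ≤ H.degInto (y i) U) :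
    ∃ φ : W ↪ V, A.IsRootedCopy H y U φ := by
  classical
  set z : Fin k := ⟨0, by omega⟩ with hz
  set N := Fintype.card W with hN
  set n := Fintype.card V with hn'
  have hLex : ∀ i, ∃ L ⊆ link H (y i) U, (∃ e ∈ A.graph.edges, A.root i ∈ e) →
      c * p * (n : ℝ) ^ (k - 1) ≤ L.card ∧ (L.card : ℝ) ≤ (c + 1) * p * (n : ℝ) ^ (k - 1) := by
    intro i
    by_cases h : ∃ e ∈ A.graph.edges, A.root i ∈ e
    · obtain ⟨L, hL, h'⟩ := exists_trimmed_link hk hp (by linarith) hc hn hcodeg (hyd i h)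
      exact ⟨L, hL, fun _ => h'⟩
    · exact ⟨∅, empty_subset _, fun h' => absurd h' h⟩
  choose L hL hLc using hLex
  obtain ⟨Γ, σ, hfree, hfree_supp, hroot⟩ :=
    exists_constraintSystem A H hlin hdeg y z rfl L hL
  have hLz : ∀ i, ∀ a ∈ L i, a z = y i := fun i a ha => (mem_link.1 (hL i ha)).1 z rfl
  have hnpos : (0 : ℝ) < n := by exact_mod_cast hn
  have hpow : (0 : ℝ) < (n : ℝ) ^ (k - 1) := by positivity
  have hupper : ∀ i, Γ.IsRoot i →
      (numMaps (Γ.holds i) : ℝ) ≤ (c + 1) * p * (n : ℝ) ^ N := by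
    intro i hi
    obtain ⟨j, b, hb, hbz, -, -, hh⟩ := hroot i hi
    have hj : ∃ e ∈ A.graph.edges, A.root j ∈ e :=
      ⟨σ i, (σ i).2, by rw [← hb, ← hbz]; exact mem_map_of_mem _ (mem_univ _)⟩
    have h1 := congrArg (Nat.cast (R := ℝ)) (numMaps_link hk hn b z (L j) (y j) (hLz j))
    push_cast at h1
    refine le_of_mul_le_mul_right ?_ hpow
    rw [numMaps_congr hh, h1]
    calc _ ≤ ((c + 1) * p * (n : ℝ) ^ (k - 1)) * (n : ℝ) ^ N := by
          gcongr
          exact (hLc j hj).2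
      _ = _ := by ring
  have hlower : ∀ i, Γ.IsRoot i → ∀ B : Finset V, B.card ≤ N →
      c / 2 * p * (n : ℝ) ^ N ≤
        numMaps fun ψ : W → V => Γ.holds i ψ ∧ ∀ v ∈ Γ.supp i, ψ v ∈ U \ B := by
    intro i hi B hB
    obtain ⟨j, b, hb, hbz, hsupp, -, hh⟩ := hroot i hi
    have hj : ∃ e ∈ A.graph.edges, A.root j ∈ e :=
      ⟨σ i, (σ i).2, by rw [← hb, ← hbz]; exact mem_map_of_mem _ (mem_univ _)⟩
    set L' := (L j).filter fun a => ¬ ∃ s : Fin k, s.val ≠ 0 ∧ a s ∈ B with hL'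
    have hcard : c / 2 * p * (n : ℝ) ^ (k - 1) ≤ L'.card := by
      have h1 := card_filter_add_card_filter_not (s := L j)
        (fun a => ∃ s : Fin k, s.val ≠ 0 ∧ a s ∈ B)
      have h2 : ((L j).filter fun a => ∃ s : Fin k, s.val ≠ 0 ∧ a s ∈ B).card ≤
          N * (H.maxCodegree * k ^ k) :=
        (card_le_card (filter_subset_filter _ (hL j))).trans
          ((card_link_meeting_le hk (hyU j) B).trans (Nat.mul_le_mul_right _ hB))
      have h3 : ((L j).card : ℝ) ≤ N * (H.maxCodegree * k ^ k) + L'.card := by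
        exact_mod_cast h1 ▸ Nat.add_le_add_right h2 _
      have h4 : (N : ℝ) * (H.maxCodegree * k ^ k) ≤ c / 2 * p * (n : ℝ) ^ (k - 1) := by
        calc (N : ℝ) * (H.maxCodegree * k ^ k) ≤
            N * ((ε * p * (n : ℝ) ^ (k - 1)) * k ^ k) := by gcongr
          _ = (N * k ^ k * ε) * (p * (n : ℝ) ^ (k - 1)) := by ring
          _ ≤ (c / 2) * (p * (n : ℝ) ^ (k - 1)) := by
            gcongr
            linarith
          _ = _ := by ring
      linarith [(hLc j hj).1]
    have h1 := congrArg (Nat.cast (R := ℝ)) (numMaps_link hk hn b z L' (y j)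
      fun a ha => hLz j a (mem_filter.1 ha).1)
    push_cast at h1
    have h2 : numMaps (fun φ : W → V => Function.update (φ ∘ b) z (y j) ∈ L') ≤
        numMaps fun ψ : W → V => Γ.holds i ψ ∧ ∀ v ∈ Γ.supp i, ψ v ∈ U \ B := by
      refine numMaps_mono fun φ hφ => ?_
      obtain ⟨hφ1, hφ2⟩ := mem_filter.1 hφ
      refine ⟨(hh φ).2 hφ1, fun v hv => ?_⟩
      rw [hsupp] at hv
      obtain ⟨s, -, rfl⟩ := mem_image.1 hv
      have hs : s.1.val ≠ 0 := fun h => s.2 (Fin.ext h)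
      have hs' : Function.update (φ ∘ b) z (y j) s.1 = φ (b s) := by simp [s.2]
      refine mem_sdiff.2 ⟨?_, fun h => hφ2 ⟨s.1, hs, ?_⟩⟩
      · rw [← hs']
        exact (mem_link.1 (hL j hφ1)).2.1 s.1 hs
      · rwa [hs']
    refine le_trans ?_ (Nat.cast_le.2 h2)
    refine le_of_mul_le_mul_right ?_ hpow
    rw [h1]
    calc _ = (c / 2 * p * (n : ℝ) ^ (k - 1)) * (n : ℝ) ^ N := by ring
      _ ≤ _ := by gcongr
  -- A crude bound depending only on `N`, so that `ε` can be fixed before `A`.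
  have hm : A.graph.edges.card ≤ 2 ^ N := by
    rw [hN, ← Fintype.card_finset]
    exact card_le_univ _
  have hcount := Γ.le_injCount (K := c + 1) (κ := c / 2) hp.le hp1 hε.le hε1 (by linarith)
    (by linarith) (by linarith) (by
      calc 2 * ε * (c + 1 + 6) ^ A.graph.edges.card = 2 * ε * (c + 7) ^ A.graph.edges.card := by
            ring
        _ ≤ 2 * ε * (c + 7) ^ (2 ^ N) := by
            have : (c + 7) ^ A.graph.edges.card ≤ (c + 7) ^ (2 ^ N) :=
              pow_le_pow_right₀ (by linarith) hm
            gcongr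
        _ ≤ _ := hεκ
        _ ≤ _ := by
            have : (c / 2) ^ (2 ^ N) ≤ (c / 2) ^ A.graph.edges.card :=
              pow_le_pow_of_le_one (by linarith) (by linarith) hm
            gcongr) hH hn hupper hlower hU le_rfl
  have hpos : 0 < Γ.injCount U (univ.filter fun j => j.val < A.graph.edges.card) := by
    have : (0 : ℝ) < (c / 2) ^ A.graph.edges.card * (1 / 8) ^ N *
        (p ^ A.graph.edges.card * (n : ℝ) ^ N) := by positivity
    exact_mod_cast this.trans_le hcount
  rw [ConstraintSystem.injCount, numMaps_eq] at hpos
  obtain ⟨φ, hφ⟩ := card_pos.1 hpos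
  obtain ⟨-, hinj, hφU, hφh⟩ := mem_filter.1 hφ
  have hφh' : ∀ i, Γ.holds i φ := fun i => hφh i (mem_filter.2 ⟨mem_univ _, i.2⟩)
  -- The counted maps also give the roots values in `U`. No constraint depends on these, so they are
  -- replaced by `y`, which avoids `U`.
  set ψ : W → V := Function.extend A.root y φ with hψ
  have hψr : ∀ i, ψ (A.root i) = y i := fun i => A.root.injective.extend_apply _ _ _
  have hψn : ∀ w, w ∉ Set.range A.root → ψ w = φ w := fun w hw =>
    Function.extend_apply' _ _ _ hw
  have hψinj : Function.Injective ψ := by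
    intro v w hvw
    by_cases hv : v ∈ Set.range A.root <;> by_cases hw : w ∈ Set.range A.root
    · obtain ⟨i, rfl⟩ := hv
      obtain ⟨j, rfl⟩ := hw
      rw [hψr, hψr] at hvw
      rw [y.injective hvw]
    · obtain ⟨i, rfl⟩ := hv
      rw [hψr, hψn w hw] at hvw
      exact absurd (hvw ▸ hφU w) (hyU i)
    · obtain ⟨j, rfl⟩ := hw
      rw [hψr, hψn v hv] at hvw
      exact absurd (hvw ▸ hφU v) (hyU j)
    · rw [hψn v hv, hψn w hw] at hvw
      exact hinj hvw
  refine ⟨⟨ψ, hψinj⟩, ?_, hψr, fun w hw => ?_⟩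
  · intro e he
    obtain ⟨i, hi⟩ := σ.surjective ⟨e, he⟩
    have hie : (σ i : Finset W) = e := congrArg Subtype.val hi
    rw [map_eq_image, Function.Embedding.coeFn_mk]
    by_cases hr : Γ.IsRoot i
    · obtain ⟨j, b, hb, hbz, hsupp, hbr, hh⟩ := hroot i hr
      have h1 := (mem_link.1 (hL j ((hh φ).1 (hφh' i)))).2.2
      convert h1 using 1
      rw [← hie, ← hb, map_eq_image, image_image]
      refine image_congr fun s _ => ?_
      by_cases hs : s = z
      · simp [hs, hbz, hψr]
      · simp [hs, hψn _ (hbr s hs)]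
    · have h1 := (Γ.holds_iff i φ hr).1 (hφh' i)
      rw [hfree_supp i hr, hie] at h1
      convert h1 using 1
      refine image_congr fun w hw => hψn w ?_
      rintro ⟨j, rfl⟩
      exact hfree i hr j (hie ▸ hw)
  · change ψ w ∈ U
    rw [hψn w hw]
    exact hφU w

end Rooted

/-! ### Low degrees and deletion of vertices -/

section Degrees

variable {V : Type*} [Fintype V] [DecidableEq V] {k ℓ : ℕ} {H : KGraph k V}

theorem edgeCount_le_sum_degInto (hk : 2 ≤ k) (B U : Finset V) :
    H.edgeCount (fun i : Fin k => if i.val = 0 then B else U) ≤ ∑ v ∈ B, H.degInto v U := by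
  simp only [← card_link]
  refine le_trans (card_le_card fun a ha => ?_) card_biUnion_le
  obtain ⟨ha, he⟩ := mem_filter.1 ha
  rw [Fintype.mem_piFinset] at ha
  refine mem_biUnion.2 ⟨a ⟨0, by omega⟩, by simpa using ha ⟨0, by omega⟩, mem_link.2 ⟨?_, ?_, he⟩⟩
  · intro i hi
    congr 1
    exact Fin.ext hi
  · intro i hi
    simpa [hi] using ha i

/-- If the low-degree set `B` were larger, the box `B × U × ⋯ × U` would reach the threshold (here
`p^ℓ ≤ p` needs `ℓ ≥ 1`) and have at least `(1 - ε) p |B| |U|^(k-1)` edges, more than its degrees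
allow. -/
theorem card_low_degree_le (hk : 2 ≤ k) (hℓ : 1 ≤ ℓ) {p ε : ℝ} (hp : 0 < p) (hp1 : p ≤ 1)
    (hε : 0 < ε) (hε1 : ε ≤ 1 / 2) (hH : H.IsPseudoRandom p (ε * p ^ ℓ) ε)
    (hn : 0 < Fintype.card V) {U : Finset V} (hU : (Fintype.card V : ℝ) / 4 ≤ U.card)
    (Y : Finset V) :
    ((Y.filter fun v => (H.degInto v U : ℝ) <
      1 / 2 * (1 / 4) ^ (k - 1) * p * (Fintype.card V : ℝ) ^ (k - 1)).card : ℝ) ≤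
      4 ^ (k - 1) * ε * p * Fintype.card V := by
  set n : ℝ := ((Fintype.card V : ℕ) : ℝ) with hn'
  have hnpos : 0 < n := by
    rw [hn']
    exact_mod_cast hn
  set B := Y.filter fun v => (H.degInto v U : ℝ) <
      1 / 2 * (1 / 4) ^ (k - 1) * p * n ^ (k - 1) with hB
  by_contra! hlt
  have hBpos : (0 : ℝ) < B.card := lt_of_le_of_lt (by positivity) hlt
  have hUpow : (1 / 4 : ℝ) ^ (k - 1) * n ^ (k - 1) ≤ (U.card : ℝ) ^ (k - 1) := by
    rw [← mul_pow]
    gcongr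
    linarith
  have hprod : ∏ i : Fin k, (((if i.val = 0 then B else U).card : ℕ) : ℝ) =
      B.card * (U.card : ℝ) ^ (k - 1) := by
    obtain ⟨j, rfl⟩ : ∃ j, k = j + 1 := ⟨k - 1, by omega⟩
    rw [Fin.prod_univ_succ]
    simp
  have hge : ε * p ^ ℓ * n ^ k ≤
      ∏ i : Fin k, (((if i.val = 0 then B else U).card : ℕ) : ℝ) := by
    rw [hprod]
    have hpℓ : p ^ ℓ ≤ p := by
      simpa using pow_le_pow_of_le_one hp.le hp1 hℓ
    have h44 : (4 : ℝ) ^ (k - 1) * (1 / 4) ^ (k - 1) = 1 := by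
      rw [← mul_pow]
      norm_num
    calc ε * p ^ ℓ * n ^ k ≤ ε * p * n ^ k := by gcongr
      _ = ε * p * (n ^ (k - 1) * n) := by
          rw [← pow_succ]
          congr 2
          omega
      _ = (4 ^ (k - 1) * ε * p * n) * ((1 / 4) ^ (k - 1) * n ^ (k - 1)) := by
          linear_combination (-(ε * p * n * n ^ (k - 1))) * h44
      _ ≤ B.card * (U.card : ℝ) ^ (k - 1) := by gcongr
  have h1 := (hH (fun i : Fin k => if i.val = 0 then B else U) hge).1
  rw [hprod] at h1
  have h2 : (H.edgeCount (fun i : Fin k => if i.val = 0 then B else U) : ℝ) ≤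
      ∑ v ∈ B, (H.degInto v U : ℝ) := by
    exact_mod_cast edgeCount_le_sum_degInto hk B U
  have h3 : ∑ v ∈ B, (H.degInto v U : ℝ) <
      B.card * (1 / 2 * (1 / 4) ^ (k - 1) * p * n ^ (k - 1)) := by
    rw [← nsmul_eq_mul, ← sum_const]
    exact sum_lt_sum_of_nonempty (card_pos.1 (by exact_mod_cast hBpos))
      fun v hv => (mem_filter.1 hv).2
  have h4 : B.card * (1 / 2 * (1 / 4) ^ (k - 1) * p * n ^ (k - 1)) ≤
      (1 - ε) * p * (B.card * (U.card : ℝ) ^ (k - 1)) := by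
    calc _ = 1 / 2 * p * (B.card * ((1 / 4) ^ (k - 1) * n ^ (k - 1))) := by ring
      _ ≤ (1 - ε) * p * (B.card * (U.card : ℝ) ^ (k - 1)) := by
          have h5 : 1 / 2 ≤ 1 - ε := by linarith
          have h6 : 0 ≤ 1 - ε := by linarith
          gcongr
  linarith

/-- The lost tuples have an entry in `Z` at a position other than the first; the remaining `k - 2`
entries are bounded trivially. The loss is harmless once `|Z|` is a small multiple of `p n`. -/
theorem degInto_le_add (hk : 2 ≤ k) (v : V) (U Z : Finset V) :
    H.degInto v U ≤ H.degInto v (U \ Z) + k * (Z.card * Fintype.card V ^ (k - 2)) := by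
  classical
  set z : Fin k := ⟨0, by omega⟩ with hz
  set C : Fin k → Fin k → Finset V := fun i s =>
    if s = z then {v} else if s = i then Z else univ with hC
  have hsub : link H v U ⊆ link H v (U \ Z) ∪
      (univ.erase z).biUnion fun i => Fintype.piFinset (C i) := by
    intro a ha
    obtain ⟨h0, hU, he⟩ := mem_link.1 ha
    by_cases h : ∃ i : Fin k, i.val ≠ 0 ∧ a i ∈ Z
    · obtain ⟨i, hi, hiZ⟩ := h
      have hiz : i ≠ z := fun h => hi (by rw [h])
      refine mem_union_right _ (mem_biUnion.2 ⟨i, mem_erase.2 ⟨hiz, mem_univ _⟩,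
        Fintype.mem_piFinset.2 fun s => ?_⟩)
      by_cases hs : s = z
      · simp [hC, hs, h0 z rfl]
      · by_cases hsi : s = i
        · simp [hC, hsi, hiz, hiZ]
        · simp [hC, hs, hsi]
    · push Not at h
      exact mem_union_left _ (mem_link.2 ⟨h0, fun i hi => mem_sdiff.2 ⟨hU i hi, h i hi⟩, he⟩)
  have hcard : ∀ i ∈ (univ : Finset (Fin k)).erase z,
      (Fintype.piFinset (C i)).card ≤ Z.card * Fintype.card V ^ (k - 2) := by
    intro i hi
    have hiz := ne_of_mem_erase hi
    rw [Fintype.card_piFinset, ← mul_prod_erase univ _ (mem_univ z), ← mul_prod_erase _ _ hi]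
    have h1 : ∏ s ∈ (univ.erase z).erase i, (C i s).card =
        ∏ s ∈ (univ.erase z).erase i, Fintype.card V := by
      refine prod_congr rfl fun s hs => ?_
      have hsi := ne_of_mem_erase hs
      have hsz := ne_of_mem_erase (mem_of_mem_erase hs)
      simp [hC, hsi, hsz]
    rw [h1, prod_const, card_erase_of_mem hi, card_erase_of_mem (mem_univ z), card_univ,
      Fintype.card_fin, Nat.sub_sub]
    simp [hC, hiz]
  rw [← card_link, ← card_link]
  refine (card_le_card hsub).trans ((card_union_le _ _).trans (Nat.add_le_add_left ?_ _))
  refine (card_biUnion_le_card_mul _ _ _ hcard).trans (Nat.mul_le_mul_right _ ?_)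
  exact (card_le_univ _).trans_eq (Fintype.card_fin k)

theorem le_degInto_sdiff (hk : 2 ≤ k) {v : V} {U Z : Finset V} {c p : ℝ}
    (hZ : k * (Z.card : ℝ) ≤ c * (p * Fintype.card V))
    (hd : (c + c) * p * (Fintype.card V : ℝ) ^ (k - 1) ≤ H.degInto v U) :
    c * p * (Fintype.card V : ℝ) ^ (k - 1) ≤ H.degInto v (U \ Z) := by
  have h1 : (H.degInto v U : ℝ) ≤
      H.degInto v (U \ Z) + k * (Z.card * (Fintype.card V : ℝ) ^ (k - 2)) := by
    exact_mod_cast degInto_le_add hk v U Z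
  have h2 : (Fintype.card V : ℝ) ^ (k - 1) = Fintype.card V * (Fintype.card V : ℝ) ^ (k - 2) := by
    rw [← pow_succ']
    congr 1
    omega
  have h3 : k * (Z.card * (Fintype.card V : ℝ) ^ (k - 2)) ≤
      c * p * (Fintype.card V : ℝ) ^ (k - 1) := by
    rw [h2]
    calc _ = (k * (Z.card : ℝ)) * (Fintype.card V : ℝ) ^ (k - 2) := by ring
      _ ≤ (c * (p * Fintype.card V)) * (Fintype.card V : ℝ) ^ (k - 2) := by gcongr
      _ = _ := by ring
  linarith

end Degrees

/-! ### Disjoint families of copies -/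

section Families

variable {k r : ℕ} {W V : Type*} [Fintype W] [DecidableEq W] [Fintype V] [DecidableEq V]

/-- A partial family of pairwise disjoint sets can be extended greedily until no further index
of `S` can be added. -/
theorem exists_maximal_extension {I : Type*} (P : I → Finset V → Prop) (D S : Finset I)
    (g : I → Finset V) (hg : (D : Set I).PairwiseDisjoint g) :
    ∃ (D' : Finset I) (g' : I → Finset V), D ⊆ D' ∧ (∀ e ∈ D', e ∈ D ∨ e ∈ S) ∧
      (∀ e ∈ D, g' e = g e) ∧ (∀ e ∈ D', e ∉ D → P e (g' e)) ∧
      (D' : Set I).PairwiseDisjoint g' ∧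
      ∀ e ∈ S, e ∉ D' → ∀ X, P e X → ¬ Disjoint X (D'.biUnion g') := by
  classical
  induction hs : (S \ D).card generalizing D g with
  | zero =>
    have : S ⊆ D := sdiff_eq_empty_iff_subset.1 (card_eq_zero.1 hs)
    exact ⟨D, g, Subset.rfl, fun e he => Or.inl he, fun _ _ => rfl, fun e he he' => absurd he he',
      hg, fun e he he' => absurd (this he) he'⟩
  | succ s ih =>
    by_cases hex : ∃ e ∈ S, e ∉ D ∧ ∃ X, P e X ∧ Disjoint X (D.biUnion g)
    · obtain ⟨e, heS, heD, X, hX, hXd⟩ := hex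
      have hne : ∀ x ∈ D, x ≠ e := fun x hx h => heD (h ▸ hx)
      have hupd : ∀ x ∈ D, Function.update g e X x = g x := fun x hx =>
        Function.update_of_ne (hne x hx) _ _
      have hg1 : ((insert e D : Finset I) : Set I).PairwiseDisjoint (Function.update g e X) := by
        rw [coe_insert]
        refine Set.PairwiseDisjoint.insert_of_notMem ?_ (by simpa using heD) fun x hx => ?_
        · intro x hx x' hx' hxx'
          simp only [Function.onFun]
          rw [hupd x hx, hupd x' hx']
          exact hg hx hx' hxx'
        · rw [Function.update_self, hupd x hx]
          exact hXd.mono_right (subset_biUnion_of_mem g hx)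
      have hcard : (S \ insert e D).card = s := by
        have h : S \ insert e D = (S \ D).erase e := by
          ext x
          simp only [mem_sdiff, mem_insert, mem_erase]
          tauto
        rw [h, card_erase_of_mem (mem_sdiff.2 ⟨heS, heD⟩), hs]
        rfl
      obtain ⟨D', g', h1, h2, h3, h4, h5, h6⟩ := ih (insert e D) _ hg1 hcard
      refine ⟨D', g', (subset_insert _ _).trans h1, fun x hx => ?_, fun x hx => ?_,
        fun x hx hxD => ?_, h5, h6⟩
      · rcases h2 x hx with h | h
        · rcases mem_insert.1 h with rfl | h
          · exact Or.inr heS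
          · exact Or.inl h
        · exact Or.inr h
      · rw [h3 x (mem_insert_of_mem hx), hupd x hx]
      · by_cases hxe : x = e
        · subst hxe
          rw [h3 x (mem_insert_self _ _), Function.update_self]
          exact hX
        · exact h4 x hx (by simp [hxe, hxD])
    · push Not at hex
      exact ⟨D, g, Subset.rfl, fun e he => Or.inl he, fun _ _ => rfl,
        fun e he he' => absurd he he', hg, hex⟩

/-- The set `X` consists of the images of the non-root vertices in some rooted copy of `A` in `H`
with roots `e`, and it is contained in `U`. -/
def IsCopySet (A : RootedKGraph k r W) (H : KGraph k V) (U : Finset V) (e : Fin r ↪ V)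
    (X : Finset V) : Prop :=
  ∃ φ : W ↪ V, A.IsRootedCopy H e U φ ∧ ((univ.map A.root)ᶜ).map φ = X

namespace IsCopySet

variable {A : RootedKGraph k r W} {H : KGraph k V} {U U' : Finset V} {e : Fin r ↪ V}
  {X : Finset V}

theorem subset (h : IsCopySet A H U e X) : X ⊆ U := by
  obtain ⟨φ, ⟨-, -, hφ⟩, rfl⟩ := h
  intro v hv
  obtain ⟨w, hw, rfl⟩ := mem_map.1 hv
  exact hφ w (by simpa using hw)

theorem mono (h : IsCopySet A H U e X) (hU : U ⊆ U') : IsCopySet A H U' e X := by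
  obtain ⟨φ, ⟨h1, h2, h3⟩, hX⟩ := h
  exact ⟨φ, ⟨h1, h2, fun w hw => hU (h3 w hw)⟩, hX⟩

theorem card_eq (h : IsCopySet A H U e X) : X.card = Fintype.card W - r := by
  obtain ⟨φ, -, rfl⟩ := h
  rw [card_map, card_compl, card_map, card_univ, Fintype.card_fin]

end IsCopySet

theorem _root_.RootedKGraph.IsRootedCopy.exists_isCopySet {A : RootedKGraph k r W}
    {H : KGraph k V} {U : Finset V} {e : Fin r ↪ V} {φ : W ↪ V} (h : A.IsRootedCopy H e U φ) :
    ∃ X, IsCopySet A H U e X := ⟨_, φ, h, rfl⟩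

/-- Compatibility reduces to disjointness of the non-root parts: each copy is its root tuple inside
`T.verts` together with a set outside. -/
theorem exists_isCompatibleFamily (T : OrderedGraph r V) (A : RootedKGraph k r W)
    (H : KGraph k V) (g : (Fin r ↪ V) → Finset V)
    (hg : ∀ e ∈ T.edges, IsCopySet A H (univ \ T.verts) e (g e))
    (hd : (T.edges : Set (Fin r ↪ V)).PairwiseDisjoint g) :
    ∃ φ : T.edges → (W ↪ V), T.IsCompatibleFamily A H φ := by
  choose φ hφ hX using fun e : T.edges => hg e e.2
  have himage : ∀ e : T.edges, univ.map (φ e) = univ.map (e : Fin r ↪ V) ∪ g e := by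
    intro e
    rw [← hX e, ← union_compl (univ.map A.root), map_union]
    congr 1
    rw [map_map]
    congr 1
    ext i
    exact (hφ e).2.1 i
  have hverts : ∀ e : T.edges, univ.map (e : Fin r ↪ V) ⊆ T.verts := by
    intro e v hv
    obtain ⟨i, -, rfl⟩ := mem_map.1 hv
    exact T.mem_verts e e.2 i
  have hdisj : ∀ e : T.edges, Disjoint (g e) T.verts := fun e =>
    disjoint_of_subset_left (hg e e.2).subset sdiff_disjoint
  refine ⟨φ, fun e => ⟨(hφ e).1, (hφ e).2.1, fun _ _ => mem_univ _⟩, fun e => ?_,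
    fun e e' hee' => ?_⟩
  · rw [himage, union_inter_distrib_right, disjoint_iff_inter_eq_empty.1 (hdisj e), union_empty,
      inter_eq_left.2 (hverts e)]
  · have h1 := disjoint_iff_inter_eq_empty.1 (disjoint_of_subset_right (hverts e') (hdisj e))
    have h2 := disjoint_iff_inter_eq_empty.1
      (disjoint_of_subset_right (hverts e) (hdisj e')).symm
    have h3 := disjoint_iff_inter_eq_empty.1
      (hd e.2 e'.2 fun h => hee' (Subtype.ext h))
    rw [himage, himage, union_inter_distrib_right, inter_union_distrib_left,
      inter_union_distrib_left, h1, h2, h3]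
    simp

theorem card_filter_exists_mem_le (T : OrderedGraph r V) {Δ : ℕ} (hΔ : T.maxDegree ≤ Δ)
    (B : Finset V) (hB : B ⊆ T.verts) :
    (T.edges.filter fun e => ∃ i, e i ∈ B).card ≤ B.card * Δ := by
  have hsub : (T.edges.filter fun e => ∃ i, e i ∈ B) ⊆
      B.biUnion fun v => T.edges.filter fun e => v ∈ univ.map e := by
    intro e he
    obtain ⟨he, i, hi⟩ := mem_filter.1 he
    exact mem_biUnion.2 ⟨e i, hi, mem_filter.2 ⟨he, mem_map_of_mem _ (mem_univ _)⟩⟩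
  refine (card_le_card hsub).trans (card_biUnion_le_card_mul _ _ _ fun v hv => ?_)
  exact (le_sup (f := fun v => (T.edges.filter fun e => v ∈ univ.map e).card) (hB hv)).trans hΔ

/-- The maximum with `1` covers `r = 0`, where the empty tuple may be an edge although no vertex
lies in it. -/
theorem card_edges_le (T : OrderedGraph r V) {Δ : ℕ} (hΔ : T.maxDegree ≤ Δ) :
    T.edges.card ≤ max (T.verts.card * Δ) 1 := by
  rcases Nat.eq_zero_or_pos r with rfl | hr
  · exact le_max_of_le_right (card_le_one.2 fun e _ e' _ => Subsingleton.elim _ _)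
  · refine le_max_of_le_left ((card_le_card fun e he => ?_).trans
      (card_filter_exists_mem_le T hΔ T.verts Subset.rfl))
    exact mem_filter.2 ⟨he, ⟨0, hr⟩, T.mem_verts e he _⟩

/-- When every vertex is a root, `A` has no edges: an edge would contain two distinct roots and be
disjoint from itself. -/
theorem exists_isCopySet_of_card_eq (hk : 2 ≤ k) (A : RootedKGraph k r W) (H : KGraph k V)
    (hW : Fintype.card W = r) (U : Finset V) (e : Fin r ↪ V) : IsCopySet A H U e ∅ := by
  have hbij : Function.Bijective A.root :=
    (Fintype.bijective_iff_injective_and_card _).2 ⟨A.root.injective, by simp [hW]⟩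
  let ρ := Equiv.ofBijective A.root hbij
  have hρ : ∀ i, ρ.symm (A.root i) = i := fun i => ρ.symm_apply_apply i
  refine ⟨ρ.symm.toEmbedding.trans e, ⟨fun E hE => ?_, fun i => by simp [hρ], fun w hw =>
    absurd (hbij.2 w) hw⟩, ?_⟩
  · have h1 : 1 < E.card := by
      rw [A.graph.uniform E hE]
      omega
    obtain ⟨a, ha, b, hb, hab⟩ := one_lt_card.1 h1
    obtain ⟨i, rfl⟩ := hbij.2 a
    obtain ⟨j, rfl⟩ := hbij.2 b
    exact absurd (congrArg A.root (eq_of_root_mem hE ha hb)) hab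
  · have : univ.map A.root = univ := by
      rw [map_eq_image]
      exact image_univ_of_surjective hbij.2
    simp [this]

end Families

/-! ### The three rounds and the choice of constants -/

section Assembly

variable {k r : ℕ} {W V : Type*} [Fintype W] [DecidableEq W] [Fintype V] [DecidableEq V]

theorem card_biUnion_copies_le {A : RootedKGraph k r W} {H : KGraph k V} {U : Finset V}
    {D : Finset (Fin r ↪ V)} {g : (Fin r ↪ V) → Finset V} {f : ℕ} (hW : Fintype.card W = r + f)
    (hD : ∀ e ∈ D, IsCopySet A H U e (g e)) : (D.biUnion g).card ≤ D.card * f :=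
  card_biUnion_le_card_mul _ _ _ fun e he => by
    rw [(hD e he).card_eq, hW]
    omega

/-- If at most `b` edges of `T` are bad for any large set, then the edges of `T` can be treated in
three rounds: those bad for `U₂`, those which can greedily be embedded into `U₁`, and the rest. -/
theorem exists_pairwiseDisjoint_copies {A : RootedKGraph k r W} {H : KGraph k V}
    {T : OrderedGraph r V} {f : ℕ} (hW : Fintype.card W = r + f) {b : ℝ}
    (Good : Finset V → (Fin r ↪ V) → Prop) {n : ℝ} (hn : 4 ≤ n) (hnV : Fintype.card V = n)
    (hbad : ∀ U : Finset V, n / 4 ≤ U.card → ∀ S ⊆ T.edges, (∀ e ∈ S, ¬ Good U e) →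
      (S.card : ℝ) ≤ b)
    (hall : ∀ Z : Finset V, (Z.card : ℝ) ≤ f * b → n / 4 ≤ ((univ \ T.verts) \ Z).card →
      ∀ e ∈ T.edges, ∃ X, IsCopySet A H ((univ \ T.verts) \ Z) e X)
    (hgood : ∀ U ⊆ univ \ T.verts, ∀ Z : Finset V, (Z.card : ℝ) ≤ f * (b + b) →
      n / 4 ≤ (U \ Z).card → ∀ e ∈ T.edges, Good U e → ∃ X, IsCopySet A H (U \ Z) e X)
    (hb : 0 ≤ b)
    (hY : 200 * (T.verts.card : ℝ) ≤ n) (hT : 200 * ((T.edges.card : ℝ) * f) ≤ n) :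
    ∃ g : (Fin r ↪ V) → Finset V, (∀ e ∈ T.edges, IsCopySet A H (univ \ T.verts) e (g e)) ∧
      (T.edges : Set (Fin r ↪ V)).PairwiseDisjoint g := by
  classical
  have hcardY : (((univ : Finset V) \ T.verts).card : ℝ) = n - T.verts.card := by
    rw [cast_card_sdiff (subset_univ _), card_univ, hnV]
  obtain ⟨U₂, hU₂, hU₂c⟩ := exists_subset_card_eq (s := (univ : Finset V) \ T.verts)
    (n := Fintype.card V / 2) (by
      have h1 : ((Fintype.card V / 2 : ℕ) : ℝ) ≤ (Fintype.card V : ℝ) / 2 := Nat.cast_div_le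
      have h2 : ((Fintype.card V / 2 : ℕ) : ℝ) ≤ (((univ : Finset V) \ T.verts).card : ℝ) := by
        rw [hcardY]
        linarith
      exact_mod_cast h2)
  have hU₂lo : n / 2 - 1 / 2 ≤ U₂.card := by
    have h1 : Fintype.card V ≤ 2 * (Fintype.card V / 2) + 1 := by omega
    have h2 : (Fintype.card V : ℝ) ≤ 2 * ((Fintype.card V / 2 : ℕ) : ℝ) + 1 := by exact_mod_cast h1
    rw [hU₂c]
    linarith
  have hU₂hi : (U₂.card : ℝ) ≤ n / 2 := by
    rw [hU₂c, ← hnV]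
    exact Nat.cast_div_le
  set U₁ := ((univ : Finset V) \ T.verts) \ U₂ with hU₁
  have hU₁sub : U₁ ⊆ univ \ T.verts := sdiff_subset
  have hU₁c : (U₁.card : ℝ) = n - T.verts.card - U₂.card := by
    rw [hU₁, cast_card_sdiff hU₂, hcardY]
  have hsdiff : ∀ U Z : Finset V, (U.card : ℝ) - Z.card ≤ (U \ Z).card := fun U Z => by
    have : U.card ≤ (U \ Z).card + Z.card := by
      have := le_card_sdiff Z U
      omega
    have h : (U.card : ℝ) ≤ (U \ Z).card + Z.card := by exact_mod_cast this
    linarith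
  have hused : ∀ (D : Finset (Fin r ↪ V)) (g : (Fin r ↪ V) → Finset V), D ⊆ T.edges →
      (∀ e ∈ D, IsCopySet A H (univ \ T.verts) e (g e)) →
      ((D.biUnion g).card : ℝ) ≤ D.card * f ∧ 200 * ((D.biUnion g).card : ℝ) ≤ n := by
    intro D g hD hg
    have h1 : ((D.biUnion g).card : ℝ) ≤ D.card * f := by
      exact_mod_cast card_biUnion_copies_le hW hg
    have h2 : (D.card : ℝ) * f ≤ T.edges.card * f := by
      have : D.card ≤ T.edges.card := card_le_card hD
      gcongr
    exact ⟨h1, by linarith⟩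
  set S₀ := T.edges.filter fun e => ¬ Good U₂ e with hS₀
  have hS₀b : (S₀.card : ℝ) ≤ b := hbad U₂ (by linarith) S₀ (filter_subset _ _)
    fun e he => (mem_filter.1 he).2
  -- the edges which are bad for `U₂`
  obtain ⟨D₀, g₀, -, hD₀, -, hP₀, hd₀, hmax₀⟩ := exists_maximal_extension
    (IsCopySet A H (univ \ T.verts)) ∅ S₀ (fun _ => ∅) (by simp)
  have hD₀S : D₀ ⊆ S₀ := fun e he => (hD₀ e he).resolve_left (by simp)
  have hD₀T : D₀ ⊆ T.edges := hD₀S.trans (filter_subset _ _)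
  have hP₀' : ∀ e ∈ D₀, IsCopySet A H (univ \ T.verts) e (g₀ e) := fun e he => hP₀ e he (by simp)
  have hD₀b : (D₀.card : ℝ) ≤ b := le_trans (by exact_mod_cast card_le_card hD₀S) hS₀b
  have hS₀D : S₀ ⊆ D₀ := by
    intro e he
    by_contra heD
    obtain ⟨hu1, hu2⟩ := hused D₀ g₀ hD₀T hP₀'
    obtain ⟨X, hX⟩ := hall (D₀.biUnion g₀) (hu1.trans (by
      rw [mul_comm]
      gcongr)) (by
        have := hsdiff (univ \ T.verts) (D₀.biUnion g₀)
        linarith) e (mem_filter.1 he).1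
    exact hmax₀ e he heD X (hX.mono sdiff_subset)
      (disjoint_of_subset_left hX.subset sdiff_disjoint)
  -- greedy embedding into `U₁`
  obtain ⟨D₁, g₁, hD₀₁, hD₁, hg₁, hP₁, hd₁, hmax₁⟩ := exists_maximal_extension
    (IsCopySet A H U₁) D₀ T.edges g₀ hd₀
  have hD₁T : D₁ ⊆ T.edges := fun e he => (hD₁ e he).elim (fun h => hD₀T h) id
  have hP₁' : ∀ e ∈ D₁, IsCopySet A H (univ \ T.verts) e (g₁ e) := by
    intro e he
    by_cases heD : e ∈ D₀
    · rw [hg₁ e heD]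
      exact hP₀' e heD
    · exact (hP₁ e he heD).mono hU₁sub
  have hR : ((T.edges \ D₁).card : ℝ) ≤ b := by
    obtain ⟨-, hu2⟩ := hused D₁ g₁ hD₁T hP₁'
    have hlarge : n / 4 ≤ (U₁ \ D₁.biUnion g₁).card := by
      have := hsdiff U₁ (D₁.biUnion g₁)
      linarith
    -- A leftover edge good for the unused part of `U₁` would have a copy there, contradicting
    -- maximality.
    refine hbad (U₁ \ D₁.biUnion g₁) hlarge _ sdiff_subset fun e he hge => ?_
    obtain ⟨heT, heD⟩ := mem_sdiff.1 he
    obtain ⟨X, hX⟩ := hgood _ (sdiff_subset.trans hU₁sub) ∅ (by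
      rw [card_empty, Nat.cast_zero]
      positivity) (by rwa [sdiff_empty]) e heT hge
    rw [sdiff_empty] at hX
    exact hmax₁ e heT heD X (hX.mono sdiff_subset)
      (disjoint_of_subset_left hX.subset sdiff_disjoint)
  -- the remaining edges are embedded into `U₂`
  obtain ⟨D₂, g₂, hD₁₂, hD₂, hg₂, hP₂, hd₂, hmax₂⟩ := exists_maximal_extension
    (IsCopySet A H U₂) D₁ T.edges g₁ hd₁
  have hD₂T : D₂ ⊆ T.edges := fun e he => (hD₂ e he).elim (fun h => hD₁T h) id
  have hP₂' : ∀ e ∈ D₂, IsCopySet A H (univ \ T.verts) e (g₂ e) := by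
    intro e he
    by_cases heD : e ∈ D₁
    · rw [hg₂ e heD]
      exact hP₁' e heD
    · exact (hP₂ e he heD).mono hU₂
  have hTD : T.edges ⊆ D₂ := by
    intro e he
    by_contra heD
    have heGood : Good U₂ e := by
      by_contra h
      exact heD (hD₁₂ (hD₀₁ (hS₀D (mem_filter.2 ⟨he, h⟩))))
    obtain ⟨-, hu2⟩ := hused D₂ g₂ hD₂T hP₂'
    set Z := D₂.biUnion g₂ with hZ
    -- Copies added in the second round lie in `U₁`, so only these edges can occupy vertices of
    -- `U₂`.
    set F := D₀ ∪ (D₂ \ D₁) with hF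
    have hFD : F ⊆ D₂ := union_subset (hD₀₁.trans hD₁₂) sdiff_subset
    have hZU : Z ∩ U₂ ⊆ F.biUnion g₂ := by
      intro v hv
      obtain ⟨hvZ, hvU⟩ := mem_inter.1 hv
      obtain ⟨x, hx, hvx⟩ := mem_biUnion.1 hvZ
      refine mem_biUnion.2 ⟨x, ?_, hvx⟩
      by_contra hxF
      simp only [hF, mem_union, mem_sdiff, not_or, not_and, not_not] at hxF
      have hx1 := hxF.2 hx
      have h1 := (hP₁ x hx1 hxF.1).subset
      rw [← hg₂ x hx1] at h1
      exact (mem_sdiff.1 (h1 hvx)).2 hvU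
    have hZc : ((Z ∩ U₂).card : ℝ) ≤ f * (b + b) := by
      obtain ⟨hu3, -⟩ := hused F g₂ (hFD.trans hD₂T) fun e he => hP₂' e (hFD he)
      have h1 : ((Z ∩ U₂).card : ℝ) ≤ (F.biUnion g₂).card := by exact_mod_cast card_le_card hZU
      have h2 : (F.card : ℝ) ≤ b + b := by
        have h3 : F.card ≤ D₀.card + (T.edges \ D₁).card :=
          (card_union_le _ _).trans
            (Nat.add_le_add_left (card_le_card (sdiff_subset_sdiff hD₂T Subset.rfl)) _)
        have h4 : (F.card : ℝ) ≤ D₀.card + (T.edges \ D₁).card := by exact_mod_cast h3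
        linarith
      calc _ ≤ _ := h1
        _ ≤ _ := hu3
        _ ≤ (b + b) * f := by gcongr
        _ = _ := mul_comm _ _
    have hUZ : U₂ \ (Z ∩ U₂) = U₂ \ Z := by
      ext v
      simp only [mem_sdiff, mem_inter]
      tauto
    obtain ⟨X, hX⟩ := hgood U₂ hU₂ (Z ∩ U₂) hZc (by
      rw [hUZ]
      have := hsdiff U₂ Z
      linarith) e he heGood
    rw [hUZ] at hX
    exact hmax₂ e he heD X (hX.mono sdiff_subset)
      (disjoint_of_subset_left hX.subset sdiff_disjoint)
  exact ⟨g₂, fun e he => hP₂' e (hTD he), hd₂.subset hTD⟩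

/-- The embedding statement with explicit conditions on the constants. -/
theorem exists_isCompatibleFamily_of_small {f Δ ℓ : ℕ} (hk : 2 ≤ k) (hΔ : 1 ≤ Δ)
    (A : RootedKGraph k r W) (H : KGraph k V) (T : OrderedGraph r V)
    {p ε c c₁ : ℝ} (hε : 0 < ε) (hε1 : ε ≤ 1 / 2) (hc₁ : 0 < c₁) (hc₁1 : c₁ ≤ 1 / 2)
    (hcc : c₁ + c₁ ≤ c) (hcθ : c₁ + c₁ ≤ 1 / 2 * (1 / 4) ^ (k - 1))
    (hεc : 2 * (((r + f : ℕ) : ℝ) * k ^ k * ε) ≤ c₁)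
    (hεκ : 2 * ε * (c₁ + 7) ^ (2 ^ (r + f)) ≤ (c₁ / 2) ^ (2 ^ (r + f)) * (1 / 8) ^ (r + f))
    (hεb : k * (2 * f * Δ * 4 ^ (k - 1)) * ε ≤ c₁)
    (hn : 200 * (r + f) + 4 ≤ Fintype.card V) (hW : Fintype.card W = r + f)
    (hlin : A.graph.IsLinear) (hp : 0 ≤ p) (hp1 : p ≤ 1) (hdeg : A.degen ≤ ℓ)
    (hℓ : (∃ e ∈ A.graph.edges, A.ContainsRoot e) → 1 ≤ ℓ)
    (hH : H.IsPseudoRandom p (ε * p ^ ℓ) ε)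
    (hcodeg : (H.maxCodegree : ℝ) < ε * p * (Fintype.card V : ℝ) ^ (k - 1))
    (hY : 200 * Δ ^ 2 * (r + f) ^ 2 * T.verts.card ≤ Fintype.card V)
    (hd : ∀ v ∈ T.verts, c * p * (Fintype.card V : ℝ) ^ (k - 1) <
      (H.degInto v (univ \ T.verts) : ℝ))
    (hT : T.maxDegree ≤ Δ) : ∃ φ : T.edges → (W ↪ V), T.IsCompatibleFamily A H φ := by
  classical
  rcases Nat.eq_zero_or_pos f with rfl | hf
  · exact exists_isCompatibleFamily T A H (fun _ => ∅)
      (fun e _ => exists_isCopySet_of_card_eq hk A H hW _ e) fun _ _ _ _ _ => disjoint_empty_left _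
  have hnpos : 0 < Fintype.card V := by omega
  set n : ℝ := ((Fintype.card V : ℕ) : ℝ) with hn'
  have hn0 : 0 < n := by
    rw [hn']
    exact_mod_cast hnpos
  -- The strict codegree inequality rules out `p = 0`.
  have hppos : 0 < p := by
    refine lt_of_le_of_ne hp fun h => ?_
    rw [← h, mul_zero, zero_mul] at hcodeg
    exact absurd hcodeg (not_lt.2 (Nat.cast_nonneg _))
  have hnlarge : 200 * ((r : ℝ) + f) + 4 ≤ n := by
    rw [hn']
    exact_mod_cast hn
  have hΔ2 : Δ ≤ Δ ^ 2 := Nat.le_self_pow two_ne_zero Δ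
  have hf2 : f ≤ (r + f) ^ 2 := (Nat.le_add_left f r).trans (Nat.le_self_pow two_ne_zero _)
  have hYn : 200 * T.verts.card ≤ Fintype.card V := by
    refine le_trans ?_ hY
    have : 1 ≤ Δ ^ 2 * (r + f) ^ 2 :=
      Nat.one_le_iff_ne_zero.2 (Nat.mul_ne_zero (by omega) (by omega))
    calc 200 * T.verts.card = 200 * 1 * T.verts.card := by ring
      _ ≤ 200 * (Δ ^ 2 * (r + f) ^ 2) * T.verts.card := by gcongr
      _ = _ := by ring
  have hTn : 200 * (T.edges.card * f) ≤ Fintype.card V := by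
    have h1 := card_edges_le T hT
    rcases le_max_iff.1 h1 with h | h
    · calc 200 * (T.edges.card * f) ≤ 200 * ((T.verts.card * Δ) * f) := by gcongr
        _ ≤ 200 * ((T.verts.card * Δ ^ 2) * (r + f) ^ 2) := by gcongr
        _ = 200 * Δ ^ 2 * (r + f) ^ 2 * T.verts.card := by ring
        _ ≤ _ := hY
    · calc 200 * (T.edges.card * f) ≤ 200 * (1 * f) := by gcongr
        _ ≤ _ := by omega
  -- At most `Δ` edges of `T` through each low-degree vertex.
  set b : ℝ := (4 ^ (k - 1) * ε * p * n) * Δ with hb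
  have hb0 : 0 ≤ b := by positivity
  have hkb : k * (f * (b + b)) ≤ c₁ * (p * n) := by
    calc k * (f * (b + b)) = (k * (2 * f * Δ * 4 ^ (k - 1)) * ε) * (p * n) := by
          rw [hb]
          ring
      _ ≤ c₁ * (p * n) := by gcongr
  have hembed : ∀ e ∈ T.edges, ∀ U ⊆ univ \ T.verts, n / 4 ≤ U.card →
      (∀ i, (∃ E ∈ A.graph.edges, A.root i ∈ E) →
        c₁ * p * n ^ (k - 1) ≤ H.degInto (e i) U) → ∃ X, IsCopySet A H U e X := by
    intro e he U hU hUc hdU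
    obtain ⟨φ, hφ⟩ := exists_isRootedCopy A H hk hlin hdeg hppos hp1 hε hε1 hc₁ hc₁1
      (by rw [hW]; exact hεc) (by rw [hW]; exact hεκ) hH hnpos hcodeg e
      (fun i h => (mem_sdiff.1 (hU h)).2 (T.mem_verts e he i))
      (by
        rw [hW]
        push_cast
        linarith) hdU
    exact hφ.exists_isCopySet
  -- Good means degree at least `2 c₁ p n^(k-1)` at every root lying in an edge of `A`: half may be
  -- lost to occupied vertices, half is needed for embedding.
  obtain ⟨g, hg, hgd⟩ := exists_pairwiseDisjoint_copies (A := A) (H := H) (T := T) hW (b := b)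
    (fun U e => ∀ i, (∃ E ∈ A.graph.edges, A.root i ∈ E) →
      (c₁ + c₁) * p * n ^ (k - 1) ≤ H.degInto (e i) U) (n := n) (by
        have : (0 : ℝ) ≤ (r : ℝ) + f := by positivity
        linarith) rfl
    (by
      intro U hU S hS hSbad
      rcases S.eq_empty_or_nonempty with rfl | ⟨e₀, he₀⟩
      · simpa using hb0
      -- A bad edge witnesses a root lying in an edge of `A`, the case in which `ℓ ≥ 1` is assumed.
      · have hℓ1 : 1 ≤ ℓ := by
          have := hSbad e₀ he₀
          push Not at this
          obtain ⟨i, ⟨E, hE, hi⟩, -⟩ := this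
          exact hℓ ⟨E, hE, i, hi⟩
        have h1 := card_low_degree_le hk hℓ1 hppos hp1 hε hε1 hH hnpos hU T.verts
        have h2 := card_filter_exists_mem_le T hT _ (filter_subset (fun v => (H.degInto v U : ℝ) <
          1 / 2 * (1 / 4) ^ (k - 1) * p * (Fintype.card V : ℝ) ^ (k - 1)) T.verts)
        have h3 : S ⊆ T.edges.filter fun e => ∃ i, e i ∈ T.verts.filter
            fun v => (H.degInto v U : ℝ) <
              1 / 2 * (1 / 4) ^ (k - 1) * p * (Fintype.card V : ℝ) ^ (k - 1) := by
          intro e he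
          have h4 := hSbad e he
          push Not at h4
          obtain ⟨i, -, hi⟩ := h4
          refine mem_filter.2 ⟨hS he, i, mem_filter.2 ⟨T.mem_verts e (hS he) i, hi.trans_le ?_⟩⟩
          gcongr
        have h4 : (S.card : ℝ) ≤ ((T.verts.filter fun v => (H.degInto v U : ℝ) <
            1 / 2 * (1 / 4) ^ (k - 1) * p * (Fintype.card V : ℝ) ^ (k - 1)).card : ℝ) * Δ := by
          exact_mod_cast (card_le_card h3).trans h2
        refine h4.trans ?_
        rw [hb]
        gcongr)
    (by
      intro Z hZ hc e he
      refine hembed e he _ sdiff_subset hc fun i _ => le_degInto_sdiff hk ?_ ?_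
      · refine le_trans ?_ hkb
        gcongr
        exact hZ.trans (by gcongr; linarith)
      · refine le_trans ?_ (hd (e i) (T.mem_verts e he i)).le
        gcongr)
    (by
      intro U hU Z hZ hc e he hgood
      refine hembed e he _ (sdiff_subset.trans hU) hc fun i hi =>
        le_degInto_sdiff hk ?_ (hgood i hi)
      refine le_trans ?_ hkb
      gcongr)
    hb0 (by rw [hn']; exact_mod_cast hYn) (by rw [hn']; exact_mod_cast hTn)
  exact exists_isCompatibleFamily T A H g hg hgd

theorem exists_pos_forall_mul_le {a b : ℝ} (ha : 0 ≤ a) (hb : 0 < b) :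
    ∃ δ : ℝ, 0 < δ ∧ ∀ ε ≤ δ, a * ε ≤ b := by
  refine ⟨b / (a + 1), by positivity, fun ε hε => ?_⟩
  calc a * ε ≤ a * (b / (a + 1)) := by gcongr
    _ = b * (a / (a + 1)) := by ring
    _ ≤ b * 1 := by
        gcongr
        rw [div_le_one (by positivity)]
        linarith
    _ = b := mul_one b

end Assembly

end RootedEmbedding

theorem lemma2p3 (k f r Δ : ℕ) (hk : 2 ≤ k) (hΔ : 1 ≤ Δ) (c : ℝ) (hc : 0 < c) :
    ∃ ε : ℝ, 0 < ε ∧ ε ≤ 1 ∧ ∃ n₀ : ℕ,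
      ∀ (W : Type*) [Fintype W] [DecidableEq W] (V : Type*) [Fintype V] [DecidableEq V]
        (A : RootedKGraph k r W) (H : KGraph k V) (p : ℝ) (ℓ : ℕ) (Y : Finset V)
        (T : OrderedGraph r V),
        n₀ < Fintype.card V →
        Fintype.card W = r + f →
        A.graph.IsLinear →
        0 ≤ p → p ≤ 1 →
        A.degen ≤ ℓ →
        ((∃ e ∈ A.graph.edges, A.ContainsRoot e) → 1 ≤ ℓ) →
        H.IsPseudoRandom p (ε * p ^ ℓ) ε →
        (H.maxCodegree : ℝ) < ε * p * (Fintype.card V : ℝ) ^ (k - 1) →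
        200 * Δ ^ 2 * (r + f) ^ 2 * Y.card ≤ Fintype.card V →
        (∀ v ∈ Y, c * p * (Fintype.card V : ℝ) ^ (k - 1) < (H.degInto v (Finset.univ \ Y) : ℝ)) →
        T.verts = Y →
        T.maxDegree ≤ Δ →
        ∃ φ : T.edges → (W ↪ V), T.IsCompatibleFamily A H φ := by
  -- Thus `2 c₁` is below both the assumed degree constant and the one typical for sets of at least
  -- `n/4` vertices.
  set c₁ : ℝ := min c (1 / 2 * (1 / 4) ^ (k - 1)) / 2 with hc₁
  have hθ : (0 : ℝ) < 1 / 2 * (1 / 4) ^ (k - 1) := by positivity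
  have hθ1 : (1 / 2 * (1 / 4) ^ (k - 1) : ℝ) ≤ 1 / 2 :=
    mul_le_of_le_one_right (by norm_num) (pow_le_one₀ (by norm_num) (by norm_num))
  have hmin : 0 < min c (1 / 2 * (1 / 4) ^ (k - 1) : ℝ) := lt_min hc hθ
  have hc₁pos : 0 < c₁ := by positivity
  have h2 : c₁ + c₁ = min c (1 / 2 * (1 / 4) ^ (k - 1)) := by
    rw [hc₁]
    ring
  have hcc : c₁ + c₁ ≤ c := h2.trans_le (min_le_left _ _)
  have hcθ : c₁ + c₁ ≤ 1 / 2 * (1 / 4) ^ (k - 1) := h2.trans_le (min_le_right _ _)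
  obtain ⟨δ₁, hδ₁, h₁⟩ := RootedEmbedding.exists_pos_forall_mul_le
    (a := 2 * (((r + f : ℕ) : ℝ) * k ^ k)) (by positivity) hc₁pos
  obtain ⟨δ₂, hδ₂, h₂⟩ := RootedEmbedding.exists_pos_forall_mul_le
    (a := 2 * (c₁ + 7) ^ (2 ^ (r + f)))
    (b := (c₁ / 2) ^ (2 ^ (r + f)) * (1 / 8) ^ (r + f)) (by positivity) (by positivity)
  obtain ⟨δ₃, hδ₃, h₃⟩ := RootedEmbedding.exists_pos_forall_mul_le
    (a := k * (2 * f * Δ * 4 ^ (k - 1))) (by positivity) hc₁pos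
  set ε : ℝ := min (1 / 2) (min δ₁ (min δ₂ δ₃)) with hε
  have hε1 : ε ≤ 1 / 2 := min_le_left _ _
  have hεδ : ε ≤ min δ₁ (min δ₂ δ₃) := min_le_right _ _
  have hεpos : 0 < ε := lt_min (by norm_num) (lt_min hδ₁ (lt_min hδ₂ hδ₃))
  have h₁' := h₁ ε (hεδ.trans (min_le_left _ _))
  have h₂' := h₂ ε (hεδ.trans ((min_le_right _ _).trans (min_le_left _ _)))
  have h₃' := h₃ ε (hεδ.trans ((min_le_right _ _).trans (min_le_right _ _)))
  refine ⟨ε, hεpos, by linarith, 200 * (r + f) + 4, ?_⟩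
  intro W _ _ V _ _ A H p ℓ Y T hn hW hlin hp hp1 hdeg hℓ hH hcodeg hY hd hTY hT
  subst hTY
  exact RootedEmbedding.exists_isCompatibleFamily_of_small hk hΔ A H T hεpos hε1 hc₁pos
    (by linarith) hcc hcθ (by linarith) (by linarith) h₃' hn.le hW hlin hp hp1 hdeg hℓ hH hcodeg
    hY hd hT
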